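/- **Corollary (Spontaneous magnetization).** Let $d\ge 3$, let $m\ge 0$, and let $G\subset U(m)$ be a compact matrix Lie group (a closed subgroup of the unitary group, for example $SU(n)$, $U(n)$, $SO(n)$), with normalized Haar measure $\mu_G$. For $\beta>0$ let $\rho_\beta$ be the probability measure on $G$ with density proportional to $e^{\beta\,\mathrm{Re}\,\mathrm{Tr}\,\Omega}$ with respect to $\mu_G$. The Nishimori disorder at inverse temperature $\beta$ is a family $\omega=(\Omega_{i,j})$ of $G$-valued random variables on the oriented nearest-neighbour edges of $\mathbb Z^d$ with $\Omega_{j,i}=\Omega_{i,j}^*$, independent over distinct undirected edges, each with law $\rho_\beta$. Let $\Lambda_n=\{-n,\dots,n\}^d$ and let $\partial\Lambda_n\subset\Lambda_n$ be any set of boundary sites that contains every site of $\Lambda_n$ with a nearest neighbour outside $\Lambda_n$. For a disorder $\omega$, let $\langle\cdot\rangle^0_{\omega,\beta,\Lambda_n}$ be the quenched Gibbs measure with Dirichlet boundary conditions: the probability measure on configurations $U=(U(x))_x$ with $U(x)=\mathrm{Id}$ for $x\in\partial\Lambda_n$, given by the weight $$\exp\Big(\tfrac{\beta}{2}\sum_{(i,j)}\mathrm{Re}\,\mathrm{Tr}\big(U^*(i)\,\Omega_{i,j}\,U(j)\big)\Big)\prod_{x\in\Lambda_n\setminus\partial\Lambda_n}d\mu_G(U(x)),$$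 where the sum runs over the oriented nearest-neighbour edges with both endpoints in $\Lambda_n$. View it as a probability measure on $G^{\mathbb Z^d}$ by setting $U(x)=\mathrm{Id}$ for $x\notin\Lambda_n$. There exist constants $\beta^*>0$ and $a>0$, depending only on $d$ and $G$, such that for every $\beta\ge\beta^*$ and every choice of the sets $\partial\Lambda_n$ as above the following holds. Let $\omega$ be the Nishimori disorder at inverse temperature $\beta$ on all of $\mathbb Z^d$, and let $(\omega,\widetilde{\langle\cdot\rangle}^0_{|\omega,\beta,\mathbb Z^d})$ be any limit in law, along a subsequence $n_k\to\infty$, of the pairs $(\omega,\langle\cdot\rangle^0_{\omega,\beta,\Lambda_{n}})$, where probability measures on $G^{\mathbb Z^d}$ carry the weak topology. Then $$\mathbb E\Big[\,\widetilde{\big\langle \mathrm{Re}\,\mathrm{Tr}\,U(0)\big\rangle}^0_{|\omega,\beta,\mathbb Z^d}\Big]\;\ge\;\Big(1-\sqrt{\tfrac{a\log\beta}{\beta}}\Big)\,\mathrm{Tr}\,\mathrm{Id}_G,$$ where $\mathbb E$ is the expectation over the random pair. -/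

import Mathlib

open MeasureTheory Filter Topology

noncomputable section

namespace NishimoriSpin

/-! ### Compact matrix groups

A compact matrix Lie group is a compact (equivalently, closed) subgroup `G` of the unitary group
`U(m)`; for `g ∈ G` the conjugate transpose `g*` is the inverse `g⁻¹`. -/

variable {m : ℕ}

/-- `G` carries its Borel σ-algebra. -/
instance instMeasurableSpaceGroup (G : Subgroup (Matrix.unitaryGroup (Fin m) ℂ)) :
    MeasurableSpace G := borel G

instance instBorelSpaceGroup (G : Subgroup (Matrix.unitaryGroup (Fin m) ℂ)) : BorelSpace G := ⟨rfl⟩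

instance instSecondCountableGroup (G : Subgroup (Matrix.unitaryGroup (Fin m) ℂ)) :
    SecondCountableTopology G := by
  have : SecondCountableTopology (Matrix (Fin m) (Fin m) ℂ) :=
    inferInstanceAs (SecondCountableTopology (Fin m → Fin m → ℂ))
  have : SecondCountableTopology (Matrix.unitaryGroup (Fin m) ℂ) :=
    TopologicalSpace.Subtype.secondCountableTopology _
  exact TopologicalSpace.Subtype.secondCountableTopology _

/-- The real part of the trace of the matrix `g`. -/
def reTr {G : Subgroup (Matrix.unitaryGroup (Fin m) ℂ)} (g : G) : ℝ :=
  (Matrix.trace ((g : Matrix.unitaryGroup (Fin m) ℂ) : Matrix (Fin m) (Fin m) ℂ)).re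

theorem continuous_reTr {G : Subgroup (Matrix.unitaryGroup (Fin m) ℂ)} :
    Continuous (reTr : G → ℝ) :=
  Complex.continuous_re.comp
    (Continuous.matrix_trace (continuous_subtype_val.comp continuous_subtype_val))

/-- The normalized Haar measure of the compact group `G`. -/
def haarG (G : Subgroup (Matrix.unitaryGroup (Fin m) ℂ)) [CompactSpace G] : Measure G :=
  Measure.haarMeasure ⊤

instance instIsProbabilityMeasureHaarG (G : Subgroup (Matrix.unitaryGroup (Fin m) ℂ))
    [CompactSpace G] : IsProbabilityMeasure (haarG G) :=
  ⟨by simpa [haarG] using Measure.haarMeasure_self (K₀ := (⊤ : TopologicalSpace.PositiveCompacts G))⟩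

/-- A continuous function on a compact space has an integrable exponential. -/
theorem integrable_exp_of_continuous {X : Type*} [TopologicalSpace X] [CompactSpace X]
    [MeasurableSpace X] [OpensMeasurableSpace X] (μ : Measure X) [IsFiniteMeasure μ] {f : X → ℝ}
    (hf : Continuous f) : Integrable (fun x => Real.exp (f x)) μ :=
  (Real.continuous_exp.comp hf).integrable_of_hasCompactSupport
    (HasCompactSupport.of_compactSpace _)

/-! ### The Nishimori disorder on the whole lattice

The pair `(x, k)` stands for the edge from `x` to its neighbour `x + e_k`. Each undirected edge of
`ℤ^d` is listed once, with this orientation; the matrix on the reversed edge is the inverse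
(= conjugate transpose). The single-edge law below is invariant under inversion, so the choice of
orientation does not matter. -/

/-- The sites of `ℤ^d`. -/
abbrev Site (d : ℕ) : Type := Fin d → ℤ

/-- The neighbour `x + e_k` of `x`. -/
def nbr {d : ℕ} (x : Site d) (k : Fin d) : Site d := x + Pi.single k 1

/-- Disorders on `ℤ^d`: a matrix `Ω_{x, x + e_k} ∈ G` for every edge. -/
abbrev Disorder (d : ℕ) (G : Subgroup (Matrix.unitaryGroup (Fin m) ℂ)) : Type :=
  Site d × Fin d → G

/-- Spin configurations on `ℤ^d`. -/
abbrev Config (d : ℕ) (G : Subgroup (Matrix.unitaryGroup (Fin m) ℂ)) : Type :=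
  Site d → G

/-- The single-edge law `ρ_u`: the probability measure with density proportional to
`exp (u Re Tr Ω)` with respect to normalized Haar measure. -/
def edgeLaw (G : Subgroup (Matrix.unitaryGroup (Fin m) ℂ)) [CompactSpace G] (u : ℝ) : Measure G :=
  (haarG G).tilted fun g => u * reTr g

instance instIsProbabilityMeasureEdgeLaw (G : Subgroup (Matrix.unitaryGroup (Fin m) ℂ))
    [CompactSpace G] (u : ℝ) : IsProbabilityMeasure (edgeLaw G u) :=
  isProbabilityMeasure_tilted
    (integrable_exp_of_continuous _ (continuous_const.mul continuous_reTr))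

/-- The law of the disorder on all of `ℤ^d`: the edge variables are i.i.d. with law `ρ_u`. -/
def disorderLaw (d : ℕ) (G : Subgroup (Matrix.unitaryGroup (Fin m) ℂ)) [CompactSpace G] (u : ℝ) :
    Measure (Disorder d G) :=
  Measure.infinitePi fun _ => edgeLaw G u

instance instIsProbabilityMeasureDisorderLaw (d : ℕ)
    (G : Subgroup (Matrix.unitaryGroup (Fin m) ℂ)) [CompactSpace G] (u : ℝ) :
    IsProbabilityMeasure (disorderLaw d G u) :=
  inferInstanceAs (IsProbabilityMeasure (Measure.infinitePi fun _ => edgeLaw G u))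

/-! ### Finite-volume Gibbs measures with Dirichlet boundary conditions -/

/-- The box `{-n, …, n}^d`. -/
def box (d n : ℕ) : Finset (Site d) := Finset.Icc (fun _ => -(n : ℤ)) (fun _ => (n : ℤ))

/-- The interior boundary of `Λ`: the sites of `Λ` with a nearest neighbour outside `Λ`. -/
def innerBoundary {d : ℕ} (Λ : Finset (Site d)) : Set (Site d) :=
  {x | x ∈ Λ ∧ ∃ k : Fin d, x + Pi.single k 1 ∉ Λ ∨ x - Pi.single k 1 ∉ Λ}

/-- The edges of `ℤ^d` with both endpoints in `Λ`, each listed once. -/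
def edges {d : ℕ} (Λ : Finset (Site d)) : Finset (Site d × Fin d) :=
  (Λ ×ˢ Finset.univ).filter fun e => nbr e.1 e.2 ∈ Λ

/-- The sum `∑ Re Tr (U*(i) Ω_{i,j} U(j))` over the edges of `Λ`, each taken once. As
`Re Tr g = Re Tr g*`, this is half of the sum over the oriented edges. -/
def interaction {d : ℕ} {G : Subgroup (Matrix.unitaryGroup (Fin m) ℂ)} (Λ : Finset (Site d))
    (ω : Disorder d G) (U : Config d G) : ℝ :=
  ∑ e ∈ edges Λ, reTr ((U e.1)⁻¹ * ω e * U (nbr e.1 e.2))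

theorem continuous_interaction {d : ℕ} {G : Subgroup (Matrix.unitaryGroup (Fin m) ℂ)}
    (Λ : Finset (Site d)) (ω : Disorder d G) : Continuous (interaction Λ ω) :=
  continuous_finsetSum _ fun e _ => continuous_reTr.comp
    (((continuous_apply e.1).inv.mul continuous_const).mul (continuous_apply (nbr e.1 e.2)))

/-- The reference law of one spin: Haar measure at the free sites `Λ \ B`, and the point mass at
the identity on the boundary `B`. Spins outside `Λ` do not enter the interaction; they are set to
the identity, so that every finite-volume measure lives on configurations on `ℤ^d`. -/
def siteLaw {d : ℕ} (G : Subgroup (Matrix.unitaryGroup (Fin m) ℂ)) [CompactSpace G]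
    (Λ B : Finset (Site d)) (x : Site d) : Measure G :=
  if x ∈ Λ \ B then haarG G else Measure.dirac 1

instance instIsProbabilityMeasureSiteLaw {d : ℕ} (G : Subgroup (Matrix.unitaryGroup (Fin m) ℂ))
    [CompactSpace G] (Λ B : Finset (Site d)) (x : Site d) :
    IsProbabilityMeasure (siteLaw G Λ B x) := by
  unfold siteLaw
  split_ifs <;> infer_instance

/-- The quenched Gibbs measure in `Λ` at inverse temperature `β` with disorder `ω` and with
Dirichlet condition `U = Id` on `B`. -/
def gibbs {d : ℕ} {G : Subgroup (Matrix.unitaryGroup (Fin m) ℂ)} [CompactSpace G] (β : ℝ)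
    (Λ B : Finset (Site d)) (ω : Disorder d G) : ProbabilityMeasure (Config d G) :=
  ⟨(Measure.infinitePi (siteLaw G Λ B)).tilted fun U => β * interaction Λ ω U,
    isProbabilityMeasure_tilted (integrable_exp_of_continuous _
      (continuous_const.mul (continuous_interaction Λ ω)))⟩

/-! ### The space of random Gibbs measures

Probability measures carry the topology of weak convergence and the σ-algebra generated by
evaluations; the latter contains all weakly open sets, so that convergence in law of random
measures is meaningful. -/

/-- On a compact metrizable space, weakly open sets of probability measures belong to the σ-algebra
generated by evaluations. -/
theorem opensMeasurableSpace_probabilityMeasure {X : Type*} [TopologicalSpace X]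
    [CompactSpace X] [TopologicalSpace.MetrizableSpace X] [SecondCountableTopology X]
    [MeasurableSpace X] [BorelSpace X] :
    OpensMeasurableSpace (ProbabilityMeasure X) := by
  let _ := TopologicalSpace.pseudoMetrizableSpacePseudoMetric (ProbabilityMeasure X)
  let ev (f : BoundedContinuousFunction X NNReal) (μ : ProbabilityMeasure X) : NNReal :=
    μ.toFiniteMeasure.testAgainstNN f
  have hev : ∀ f, Continuous (ev f) := fun f =>
    (FiniteMeasure.continuous_testAgainstNN_eval f).comp ProbabilityMeasure.toFiniteMeasure_continuous
  have hmeas : ∀ f, Measurable (ev f) := fun f =>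
    ((Measure.measurable_lintegral (by fun_prop)).comp measurable_subtype_coe).ennreal_toNNReal
  have hgen : (inferInstance : TopologicalSpace (ProbabilityMeasure X)) =
      .generateFrom {s | ∃ f U, IsOpen U ∧ s = ev f ⁻¹' U} := by
    refine le_antisymm (le_generateFrom ?_) ?_
    · rintro s ⟨f, U, hU, rfl⟩
      exact hU.preimage (hev f)
    · refine continuous_id_iff_le.mp ?_
      refine continuous_induced_rng.mpr (continuous_induced_rng.mpr ?_)
      refine @WeakBilin.continuous_of_continuous_eval _ _ _ _ _ _ _ _ _ _ _ (_) _ fun f => ?_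
      exact continuous_def.mpr fun U hU => .basic _ ⟨f, U, hU, rfl⟩
  refine ⟨?_⟩
  rw [borel_eq_generateFrom_of_subbasis hgen]
  refine MeasurableSpace.generateFrom_le ?_
  rintro s ⟨f, U, hU, rfl⟩
  exact hmeas f hU.measurableSet

instance instOpensMeasurableSpaceProbabilityMeasureConfig {d : ℕ}
    (G : Subgroup (Matrix.unitaryGroup (Fin m) ℂ)) [CompactSpace G] :
    OpensMeasurableSpace (ProbabilityMeasure (Config d G)) := by
  have : TopologicalSpace.MetrizableSpace G := TopologicalSpace.metrizableSpace_of_t3_secondCountable G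
  exact opensMeasurableSpace_probabilityMeasure

end NishimoriSpin

end

noncomputable section

namespace NishimoriSpin

/-! ### Exponential moments of the number of hits -/

section Hits

open Finset Function

variable {ι : Type*} [Fintype ι] [DecidableEq ι] {A : ι → Type*} [∀ i, Fintype (A i)]

/-! On the Nishimori line the density of the disorder in the box is, up to a constant, the Gibbs
weight of the configuration U = Id. Averaging over gauge transformations then lets Id be exchanged
with a spin configuration drawn from the quenched Gibbs measure. With M = ⟨U(0)⟩ and T any gauge
covariant function of the disorder, this reads E[M* T] = E[T] (`nishimori_identity`). Taking T = M
gives E‖M‖² = Re Tr E[M] in Frobenius norm, and expanding E‖M − T‖² ≥ 0 gives E[Re Tr M] ≥ 2 Re Tr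
E[T] − E‖T‖² (`le_integral_magnetization`). It remains to exhibit a good estimator T of the spin at
the origin.

T is the ordered product of the matrices D Ω along a directed path from the origin to the boundary,
averaged over a random choice of path, with D = (E Ω)⁻¹. As D commutes with G, each product is
covariant, and it has mean Id. Two paths with K common edges have mixed second moment D*^K D^K
(`integral_transport_mul_transport`). At low temperature D is within O(√(log β / β)) of Id
(`exists_norm_meanEdge_sub_one_le`), so E‖T‖² is close to m as soon as the number of common edges
has an exponential moment bounded uniformly in the box.

This is where d ≥ 3 enters. Two directions are driven by independent multiscale walks and a third
absorbs the remaining steps. Given its past, each walk is at a prescribed place k steps later with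
probability O(k^(-2/3)), hence the pair with probability O(k^(-4/3)), which is summable
(`sum_pow_walk_hits_le`). The resulting bound does not depend on the box and passes to the limit in
law. -/

theorem sum_sum_update (i : ι) (F : (∀ i, A i) → ℝ) :
    ∑ ξ, ∑ a : A i, F (update ξ i a) = Fintype.card (A i) * ∑ ξ, F ξ := by
  -- The involution exchanges coordinate `i` of `ξ` with the fresh value.
  let e : ((∀ i, A i) × A i) ≃ ((∀ i, A i) × A i) :=
    { toFun := fun q => (update q.1 i q.2, q.1 i)
      invFun := fun q => (update q.1 i q.2, q.1 i)
      left_inv := fun q => by simp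
      right_inv := fun q => by simp }
  have h := e.sum_comp fun q => F q.1
  rw [Fintype.sum_prod_type, Fintype.sum_prod_type] at h
  simpa [e, ← Finset.mul_sum] using h

/-- Average over coordinate `i` first: `g` does not see it, and the fraction of its values producing
a hit is at most `p` whatever the other coordinates are. -/
theorem sum_hit_le [∀ i, Nonempty (A i)] (i : ι) (g : (∀ i, A i) → ℝ) (hg : ∀ ξ, 0 ≤ g ξ)
    (hgi : ∀ ξ a, g (update ξ i a) = g ξ) (H : (∀ i, A i) → Prop) [DecidablePred H] (p : ℝ)
    (hp : ∀ ξ, (#{a : A i | H (update ξ i a)} : ℝ) ≤ p * Fintype.card (A i)) :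
    ∑ ξ, (if H ξ then g ξ else 0) ≤ p * ∑ ξ, g ξ := by
  have hc : (0 : ℝ) < Fintype.card (A i) := by exact_mod_cast Fintype.card_pos
  refine le_of_mul_le_mul_left ?_ hc
  rw [← sum_sum_update i]
  calc ∑ ξ, ∑ a, (if H (update ξ i a) then g (update ξ i a) else 0)
      = ∑ ξ, (#{a : A i | H (update ξ i a)} : ℝ) * g ξ := by
        refine Finset.sum_congr rfl fun ξ _ => ?_
        simp [hgi, ← Finset.sum_filter]
    _ ≤ ∑ ξ, (p * Fintype.card (A i)) * g ξ :=
        Finset.sum_le_sum fun ξ _ => mul_le_mul_of_nonneg_right (hp ξ) (hg ξ)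
    _ = Fintype.card (A i) * (p * ∑ ξ, g ξ) := by rw [← Finset.mul_sum]; ring

/-- Telescoping over the hits: a hit at time `k` adds θ − 1 times θ to the number of later hits.
Only the future of `k` enters, which permits a backward induction in time. -/
theorem pow_hits_eq (θ : ℝ) (H : ℕ → Prop) [DecidablePred H] {M n : ℕ} (hn : n ≤ M) :
    θ ^ #{k ∈ Ioc n M | H k} =
      1 + (θ - 1) * ∑ k ∈ Ioc n M, if H k then θ ^ #{l ∈ Ioc k M | H l} else 0 := by
  induction hn using Nat.decreasingInduction with
  | self => simp
  | of_succ n hn ih =>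
    have h : Ioc n M = insert (n + 1) (Ioc (n + 1) M) := by
      ext k; simp only [mem_Ioc, mem_insert]; omega
    have h' : n + 1 ∉ Ioc (n + 1) M := by simp
    rw [h, sum_insert h', filter_insert]
    split_ifs with hH
    · rw [card_insert_of_notMem (fun hc => h' (mem_filter.1 hc).1), pow_succ]
      linear_combination ih
    · rw [ih]; ring

/-- A sequence of events on a finite product space such that the event at time `n + k` has
conditional probability at most `p k` given everything up to time `n`: the number of events that
occur has a uniformly bounded exponential moment. -/
theorem sum_pow_hits_le [∀ i, Nonempty (A i)] (start : ι → ℕ) (H : ℕ → (∀ i, A i) → Prop)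
    [∀ n, DecidablePred (H n)] (p : ℕ → ℝ) (hp : ∀ k, 0 ≤ p k) (M : ℕ) (D θ : ℝ)
    (hloc : ∀ n i, n < start i → ∀ ξ a, H n (update ξ i a) ↔ H n ξ)
    (hesc : ∀ n k, 0 < k → n + k ≤ M → ∃ i, n < start i ∧
      ∀ ξ, (#{a : A i | H (n + k) (update ξ i a)} : ℝ) ≤ p k * Fintype.card (A i))
    (hD : ∑ k ∈ Icc 1 M, p k ≤ D) (hθ : 1 ≤ θ) (hθD : (θ - 1) * D < 1) {n : ℕ} (hn : n ≤ M)
    (g : (∀ i, A i) → ℝ) (hg : ∀ ξ, 0 ≤ g ξ)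
    (hgi : ∀ i, n < start i → ∀ ξ a, g (update ξ i a) = g ξ) :
    ∑ ξ, g ξ * θ ^ #{k ∈ Ioc n M | H k ξ} ≤ (1 - (θ - 1) * D)⁻¹ * ∑ ξ, g ξ := by
  set R := (1 - (θ - 1) * D)⁻¹ with hR
  have hR0 : 0 < R := inv_pos.2 (by linarith)
  -- `R` is the fixed point of R ↦ 1 + (θ − 1) R D, so the recursion closes with the same constant.
  have hR1 : 1 + (θ - 1) * (R * D) = R := by
    have : (1 - (θ - 1) * D) * R = 1 := mul_inv_cancel₀ (by linarith)
    linear_combination -this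
  induction hm : M - n using Nat.strong_induction_on generalizing n g with
  | _ d ih =>
  subst hm
  have hG : 0 ≤ ∑ ξ, g ξ := Finset.sum_nonneg fun ξ _ => hg ξ
  -- The induction hypothesis is used from time `k` with the weight `g` times the indicator of `H
  -- k`, still determined by the past of `k`. The coordinate supplied by `hesc` for the gap `k - n`,
  -- invisible to `g`, then turns the indicator into `p (k - n)`.
  have key : ∀ k ∈ Ioc n M, ∑ ξ, (if H k ξ then g ξ else 0) * θ ^ #{l ∈ Ioc k M | H l ξ} ≤
      R * (p (k - n) * ∑ ξ, g ξ) := by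
    intro k hk
    obtain ⟨hnk, hkM⟩ := mem_Ioc.1 hk
    refine (ih (M - k) (by omega) hkM _ (fun ξ => ?_) (fun i hi ξ a => ?_) rfl).trans ?_
    · split_ifs
      exacts [hg ξ, le_rfl]
    · simp only [hloc k i hi, hgi i (hnk.trans hi)]
    · obtain ⟨i, hi, hcard⟩ := hesc n (k - n) (by omega) (by omega)
      rw [Nat.add_sub_cancel' hnk.le] at hcard
      exact mul_le_mul_of_nonneg_left (sum_hit_le i g hg (hgi i hi) (H k) _ hcard) hR0.le
  calc ∑ ξ, g ξ * θ ^ #{k ∈ Ioc n M | H k ξ}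
      = ∑ ξ, g ξ + (θ - 1) * ∑ k ∈ Ioc n M,
          ∑ ξ, (if H k ξ then g ξ else 0) * θ ^ #{l ∈ Ioc k M | H l ξ} := by
        rw [Finset.sum_comm, Finset.mul_sum, ← Finset.sum_add_distrib]
        refine Finset.sum_congr rfl fun ξ _ => ?_
        rw [pow_hits_eq θ (fun k => H k ξ) hn, mul_add, mul_one, mul_left_comm, Finset.mul_sum]
        congr 2
        exact Finset.sum_congr rfl fun k _ => by split_ifs <;> simp
    _ ≤ ∑ ξ, g ξ + (θ - 1) * ∑ k ∈ Ioc n M, R * (p (k - n) * ∑ ξ, g ξ) := by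
        have := Finset.sum_le_sum key
        have h1 : 0 ≤ θ - 1 := by linarith
        gcongr
    _ ≤ ∑ ξ, g ξ + (θ - 1) * (R * (D * ∑ ξ, g ξ)) := by
        have h1 : 0 ≤ θ - 1 := by linarith
        have h2 : ∑ k ∈ Ioc n M, p (k - n) ≤ D := by
          refine le_trans ?_ hD
          have : Ioc n M = (Icc 1 (M - n)).image (· + n) := by
            ext k; simp only [mem_Ioc, mem_image, mem_Icc]
            exact ⟨fun h => ⟨k - n, by omega, by omega⟩, by rintro ⟨l, h, rfl⟩; omega⟩
          rw [this, Finset.sum_image (by intro a _ b _ h; simpa using h)]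
          simp only [Nat.add_sub_cancel]
          exact Finset.sum_le_sum_of_subset_of_nonneg (Icc_subset_Icc le_rfl (by omega))
            fun k _ _ => hp k
        rw [← Finset.mul_sum, ← Finset.sum_mul]
        gcongr
    _ = R * ∑ ξ, g ξ := by linear_combination (∑ ξ, g ξ) * hR1

end Hits

/-! ### Unpredictable walks -/

section Walks

open Finset Function

/-- Linear interpolation between the values `x b` at the times `b * L`. -/
def interp (L : ℕ) (x : ℕ → ℝ) (t : ℕ) : ℝ :=
  x (t / L) * (1 - (t % L : ℕ) / L) + x (t / L + 1) * ((t % L : ℕ) / L)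

theorem abs_interp_succ_sub_le {L : ℕ} (hL : 0 < L) {x : ℕ → ℝ} {K : ℝ} (hx : ∀ b, 0 ≤ x b)
    (hK : ∀ b, x b ≤ K) (t : ℕ) : |interp L x (t + 1) - interp L x t| ≤ K / L := by
  have hL' : (0 : ℝ) < L := by exact_mod_cast hL
  have key : interp L x (t + 1) - interp L x t = (x (t / L + 1) - x (t / L)) / L := by
    have ht := Nat.div_add_mod t L
    have hlt := Nat.mod_lt t hL
    have hc1 : t / L * L = L * (t / L) := mul_comm _ _
    have hc2 : (t / L + 1) * L = L * (t / L) + L := by ring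
    rcases Nat.lt_or_ge (t % L + 1) L with h | h
    · have h1 : (t + 1) / L = t / L := by
        rw [Nat.div_eq_iff hL]
        constructor <;> omega
      have h2 : (t + 1) % L = t % L + 1 := by
        have := Nat.div_add_mod (t + 1) L
        rw [h1] at this
        omega
      simp only [interp, h1, h2]
      push_cast
      field_simp
      ring
    · have h1 : (t + 1) / L = t / L + 1 := by
        rw [Nat.div_eq_iff hL]
        constructor <;> omega
      have h2 : (t + 1) % L = 0 := by
        have := Nat.div_add_mod (t + 1) L
        rw [h1] at this
        have : L * (t / L + 1) = L * (t / L) + L := by ring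
        omega
      have h3 : ((t % L : ℕ) : ℝ) = L - 1 := by
        have : t % L + 1 = L := by omega
        rw [eq_sub_iff_add_eq]
        exact_mod_cast this
      simp only [interp, h1, h2, h3]
      field_simp
      ring_nf
  rw [key, abs_div, abs_of_pos hL']
  gcongr
  rw [abs_le]
  constructor <;> linarith [hx (t / L), hx (t / L + 1), hK (t / L), hK (t / L + 1)]

variable {J M : ℕ}

/-- The value of block `i.2` at scale `8 ^ (i.1 + 2)`. -/
abbrev Level (J M : ℕ) (i : Fin J × Fin (M + 2)) : Type := Fin (4 ^ (i.1.val + 2))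

/-- The values of the blocks at one scale. -/
def blockVal (x : ∀ i, Level J M i) (j : Fin J) (b : ℕ) : ℝ :=
  if h : b < M + 2 then (x (j, ⟨b, h⟩) : ℕ) else 0

/-- A function with increments in `[0, 1]` that fluctuates on every scale. -/
def height (x : ∀ i, Level J M i) (t : ℕ) : ℝ :=
  t / 2 + ∑ j : Fin J, interp (8 ^ (j.val + 2)) (blockVal x j) t

/-- The nearest-neighbour walk that follows `height`. -/
def walk (x : ∀ i, Level J M i) (t : ℕ) : ℤ := ⌊height x t⌋ - ⌊height x 0⌋

theorem walk_zero (x : ∀ i, Level J M i) : walk x 0 = 0 := sub_self _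

/-- Values below 4^(j+2) on blocks of length 8^(j+2) give slopes at most 2^(-(j+2)). Their sum stays
within the drift 1/2 of `height`, so its increments remain in [0, 1]. -/
theorem sum_half_pow_le (J : ℕ) :
    ∑ j : Fin J, (4 ^ (j.val + 2) : ℝ) / (8 ^ (j.val + 2) : ℕ) ≤ 1 / 2 := by
  rw [Fin.sum_univ_eq_sum_range fun j => (4 ^ (j + 2) : ℝ) / (8 ^ (j + 2) : ℕ)]
  suffices h : ∑ j ∈ range J, (4 ^ (j + 2) : ℝ) / (8 ^ (j + 2) : ℕ) = 1 / 2 - 1 / 2 * (1 / 2) ^ J by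
    rw [h]
    have : (0 : ℝ) ≤ 1 / 2 * (1 / 2) ^ J := by positivity
    linarith
  induction J with
  | zero => simp
  | succ J ih =>
    rw [sum_range_succ, ih]
    have : (4 ^ (J + 2) : ℝ) / (8 ^ (J + 2) : ℕ) = (1 / 2) ^ (J + 2) := by
      push_cast
      rw [← div_pow]
      norm_num
    rw [this]
    ring

theorem height_succ_sub_mem (x : ∀ i, Level J M i) (t : ℕ) :
    0 ≤ height x (t + 1) - height x t ∧ height x (t + 1) - height x t ≤ 1 := by
  have h : |∑ j : Fin J, (interp (8 ^ (j.val + 2)) (blockVal x j) (t + 1) -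
      interp (8 ^ (j.val + 2)) (blockVal x j) t)| ≤ 1 / 2 := by
    refine (abs_sum_le_sum_abs _ _).trans (le_trans (sum_le_sum fun j _ => ?_) (sum_half_pow_le J))
    refine abs_interp_succ_sub_le (by positivity) (fun b => ?_) (fun b => ?_) t
    · unfold blockVal
      split_ifs <;> positivity
    · unfold blockVal
      split_ifs with h
      · exact_mod_cast (x (j, ⟨b, h⟩)).2.le
      · positivity
  rw [sum_sub_distrib, abs_le] at h
  simp only [height, Nat.cast_add, Nat.cast_one]
  constructor <;> linarith [h.1, h.2]

theorem walk_succ (x : ∀ i, Level J M i) (t : ℕ) :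
    walk x (t + 1) = walk x t ∨ walk x (t + 1) = walk x t + 1 := by
  obtain ⟨h0, h1⟩ := height_succ_sub_mem x t
  have h2 : ⌊height x t⌋ ≤ ⌊height x (t + 1)⌋ := Int.floor_mono (by linarith)
  have h3 : ⌊height x (t + 1)⌋ ≤ ⌊height x t⌋ + 1 := by
    rw [← Int.floor_add_one]
    exact Int.floor_mono (by linarith)
  unfold walk
  omega

theorem blockVal_update (x : ∀ i, Level J M i) (i : Fin J × Fin (M + 2)) (a : Level J M i)
    (j : Fin J) (b : ℕ) : blockVal (update x i a) j b =
      if j = i.1 ∧ b = i.2 then ((a : ℕ) : ℝ) else blockVal x j b := by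
  obtain ⟨j0, b0⟩ := i
  by_cases hj : j = j0 ∧ b = b0
  · obtain ⟨rfl, rfl⟩ := hj
    simp [blockVal]
  · rw [if_neg hj]
    unfold blockVal
    split_ifs with h
    · rw [update_of_ne]
      rintro h'
      simp only [Prod.mk.injEq] at h'
      exact hj ⟨h'.1, by rw [← h'.2]⟩
    · rfl

/-- Interpolation at scale L uses block b only at times with t / L equal to b − 1 or b. The time (b
− 1) L is the `start` of that coordinate in `sum_pow_hits_le`. -/
theorem walk_update_of_lt (x : ∀ i, Level J M i) (i : Fin J × Fin (M + 2)) (a : Level J M i)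
    {t : ℕ} (ht : t < (i.2.val - 1) * 8 ^ (i.1.val + 2)) : walk (update x i a) t = walk x t := by
  have hh : ∀ s ≤ t, height (update x i a) s = height x s := by
    intro s hs
    simp only [height]
    congr 1
    refine sum_congr rfl fun j _ => ?_
    have hb : ∀ b, b ≤ s / 8 ^ (j.val + 2) + 1 → blockVal (update x i a) j b = blockVal x j b := by
      intro b hb
      rw [blockVal_update, if_neg]
      rintro ⟨rfl, rfl⟩
      have : s / 8 ^ (i.1.val + 2) < i.2.val - 1 :=
        Nat.div_lt_of_lt_mul (by rw [mul_comm]; omega)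
      revert hb this
      generalize s / 8 ^ (i.1.val + 2) = q
      omega
    simp only [interp, hb _ (Nat.le_succ _), hb _ le_rfl]
  simp only [walk, hh t le_rfl, hh 0 (Nat.zero_le _)]

theorem height_update (x : ∀ i, Level J M i) (i : Fin J × Fin (M + 2)) (a a' : Level J M i)
    (t : ℕ) : height (update x i a) t - height (update x i a') t =
      interp (8 ^ (i.1.val + 2)) (fun b => if b = i.2 then 1 else 0) t * ((a : ℕ) - (a' : ℕ)) := by
  simp only [height, add_sub_add_left_eq_sub, ← sum_sub_distrib]
  rw [Finset.sum_eq_single i.1]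
  · simp only [interp, blockVal_update, true_and]
    split_ifs <;> ring
  · intro j _ hj
    simp [interp, blockVal_update, hj]
  · simp

/-- Values spaced by at least 1/2: a half-open unit interval holds at most two of them. -/
theorem card_floor_eq_le {n : ℕ} (f : Fin n → ℝ) (w : ℝ) (hw : 1 / 2 ≤ w)
    (hf : ∀ a b, f a - f b = w * ((a : ℕ) - (b : ℕ))) (v : ℤ) : #{a | ⌊f a⌋ = v} ≤ 2 := by
  rcases (filter (fun a => ⌊f a⌋ = v) univ).eq_empty_or_nonempty with h | h
  · simp [h]
  · obtain ⟨a₀, ha₀, hmin⟩ := exists_min_image _ (fun a : Fin n => a.val) h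
    have hsub : (filter (fun a => ⌊f a⌋ = v) univ).map Fin.valEmbedding ⊆ {a₀.val, a₀.val + 1} := by
      intro b hb
      obtain ⟨a, ha, rfl⟩ := mem_map.1 hb
      have h1 := hmin a ha
      have h2 := Int.floor_eq_iff.1 (mem_filter.1 ha).2
      have h3 := Int.floor_eq_iff.1 (mem_filter.1 ha₀).2
      have h4 := hf a a₀
      have h5 : a.val < a₀.val + 2 := by
        by_contra! hc
        have : (2 : ℝ) ≤ (a.val : ℝ) - a₀.val := by
          have : ((a₀.val + 2 : ℕ) : ℝ) ≤ a.val := by exact_mod_cast hc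
          push_cast at this
          linarith
        nlinarith [h2.2, h3.1]
      simp only [Fin.valEmbedding_apply, mem_insert, mem_singleton]
      omega
    calc _ = #((filter (fun a => ⌊f a⌋ = v) univ).map Fin.valEmbedding) := (card_map _).symm
      _ ≤ _ := card_le_card hsub
      _ ≤ 2 := card_le_two

theorem card_walk_update_eq_le (x : ∀ i, Level J M i) (i : Fin J × Fin (M + 2)) {t : ℕ}
    (hi : 0 < i.2.val - 1)
    (hw : 1 / 2 ≤ interp (8 ^ (i.1.val + 2)) (fun b => if b = i.2 then 1 else 0) t) (v : ℤ) :
    #{a : Level J M i | walk (update x i a) t = v} ≤ 2 := by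
  -- At time 0 only blocks 0 and 1 matter and `hi` excludes both, so the normalisation of `walk` is
  -- unaffected.
  have h0 : ∀ a : Level J M i, ⌊height (update x i a) 0⌋ = ⌊height x 0⌋ := by
    intro a
    have h1 : (i.2.val : ℕ) ≠ 0 := by omega
    have h2 : (i.2.val : ℕ) ≠ 1 := by omega
    have : height (update x i a) 0 = height x 0 := by
      simp only [height]
      congr 1
      refine sum_congr rfl fun j _ => ?_
      simp [interp, blockVal_update, h1.symm]
    rw [this]
  refine le_trans (card_le_card ?_) (card_floor_eq_le (fun a => height (update x i a) t) _ hw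
    (fun a b => height_update x i a b t) (v + ⌊height x 0⌋))
  intro a ha
  simp only [mem_filter, mem_univ, true_and, walk, h0] at ha ⊢
  omega

/-- At scale L only the blocks t / L and t / L + 1 act at time t, with weights summing to 1, so one
has weight at least 1/2. Both start no earlier than (t / L − 1) L > t − 2L. -/
theorem exists_block {M t n L : ℕ} (hL : 0 < L) (ht : t ≤ M) (hnt : n + 2 * L ≤ t) :
    ∃ b : Fin (M + 2), n < (b.val - 1) * L ∧
      1 / 2 ≤ interp L (fun b' => if b' = b.val then 1 else 0) t := by
  have hL' : (0 : ℝ) < L := by exact_mod_cast hL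
  have h1 := Nat.div_add_mod t L
  have h2 := Nat.mod_lt t hL
  have h3 : t / L ≤ t := Nat.div_le_self _ _
  have h4 : n < (t / L - 1) * L := by
    rw [Nat.sub_mul, one_mul, mul_comm]
    omega
  rcases le_total (((t % L : ℕ) : ℝ) / L) (1 / 2) with h | h
  · exact ⟨⟨t / L, by omega⟩, h4, by simp [interp]; linarith⟩
  · refine ⟨⟨t / L + 1, by omega⟩, h4.trans_le ?_, by simpa [interp] using h⟩
    exact Nat.mul_le_mul_right _ (by simp)

/-- The bound on the probability of a hit after `k` steps. -/
def escapeProb (k : ℕ) : ℝ := 256 / 16 ^ Nat.log 8 (k / 2)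

theorem escapeProb_nonneg (k : ℕ) : 0 ≤ escapeProb k := by unfold escapeProb; positivity

/-- The shell 2·8^n ≤ k < 2·8^(n+1) has 14·8^n terms equal to 256/16^n, in total 3584/2^n. The terms
k = 0, 1 give 512, and 512 + 2·3584 = 7680. With a single walk 16^n would be 4^n and the shells
would not be summable. -/
theorem sum_escapeProb_le (M : ℕ) : ∑ k ∈ Icc 1 M, escapeProb k ≤ 7680 := by
  have h : ∀ n, ∑ k ∈ range (2 * 8 ^ n), escapeProb k ≤ 7680 - 7168 / 2 ^ n := by
    intro n
    induction n with
    | zero => norm_num [sum_range_succ, escapeProb]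
    | succ n ih =>
      rw [← sum_range_add_sum_Ico _ (show 2 * 8 ^ n ≤ 2 * 8 ^ (n + 1) by gcongr <;> norm_num)]
      have h1 : ∑ k ∈ Ico (2 * 8 ^ n) (2 * 8 ^ (n + 1)), escapeProb k = 3584 / 2 ^ n := by
        have : ∀ k ∈ Ico (2 * 8 ^ n) (2 * 8 ^ (n + 1)), escapeProb k = 256 / 16 ^ n := by
          intro k hk
          obtain ⟨h1, h2⟩ := mem_Ico.1 hk
          rw [escapeProb, Nat.log_eq_of_pow_le_of_lt_pow (m := n)]
          · omega
          · rw [Nat.div_lt_iff_lt_mul (by norm_num)]; omega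
        rw [sum_congr rfl this, sum_const, Nat.card_Ico, nsmul_eq_mul,
          show 2 * 8 ^ (n + 1) - 2 * 8 ^ n = 14 * 8 ^ n by rw [pow_succ]; omega,
          show (16 : ℝ) ^ n = 8 ^ n * 2 ^ n by rw [← mul_pow]; norm_num]
        push_cast
        field_simp
        norm_num
      rw [h1, pow_succ]
      have : (7168 : ℝ) / (2 ^ n * 2) = 3584 / 2 ^ n := by field_simp; norm_num
      have h3 : (7168 : ℝ) / 2 ^ n = 3584 / 2 ^ n + 3584 / 2 ^ n := by field_simp; norm_num
      linarith
  calc ∑ k ∈ Icc 1 M, escapeProb k ≤ ∑ k ∈ range (2 * 8 ^ M), escapeProb k := by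
        refine sum_le_sum_of_subset_of_nonneg (fun k hk => ?_) fun k _ _ => escapeProb_nonneg k
        have := (mem_Icc.1 hk).2
        have h8 : M < 8 ^ M := Nat.lt_pow_self (by norm_num)
        rw [mem_range]
        omega
    _ ≤ _ := h M
    _ ≤ 7680 := by
      have : (0 : ℝ) ≤ 7168 / 2 ^ M := by positivity
      linarith

/-- Two independent copies of the data of a walk. -/
abbrev PairLevel (J M : ℕ) (i : Fin J × Fin (M + 2)) : Type := Level J M i × Level J M i

theorem fst_update (ξ : ∀ i, PairLevel J M i) (i : Fin J × Fin (M + 2)) (a : PairLevel J M i) :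
    (fun i' => (update ξ i a i').1) = update (fun i' => (ξ i').1) i a.1 :=
  funext fun i' => Function.apply_update (fun _ (y : PairLevel J M _) => y.1) ξ _ a i'

theorem snd_update (ξ : ∀ i, PairLevel J M i) (i : Fin J × Fin (M + 2)) (a : PairLevel J M i) :
    (fun i' => (update ξ i a i').2) = update (fun i' => (ξ i').2) i a.2 :=
  funext fun i' => Function.apply_update (fun _ (y : PairLevel J M _) => y.2) ξ _ a i'

theorem card_pair_walk_update_eq_le (ξ : ∀ i, PairLevel J M i) (i : Fin J × Fin (M + 2)) {t : ℕ}
    (hi : 0 < i.2.val - 1)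
    (hw : 1 / 2 ≤ interp (8 ^ (i.1.val + 2)) (fun b => if b = i.2 then 1 else 0) t) (v₁ v₂ : ℤ) :
    #{a : PairLevel J M i | walk (fun i' => (update ξ i a i').1) t = v₁ ∧
      walk (fun i' => (update ξ i a i').2) t = v₂} ≤ 2 * 2 := by
  simp only [fst_update, snd_update]
  have h1 := card_walk_update_eq_le (fun i' => (ξ i').1) i hi hw v₁
  have h2 := card_walk_update_eq_le (fun i' => (ξ i').2) i hi hw v₂
  refine le_trans (le_of_eq ?_) (Nat.mul_le_mul h1 h2)
  rw [← card_product, ← filter_product, univ_product_univ]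

theorem mul_pow_cast_four (n : ℕ) : (16 : ℝ) ^ n = ((4 ^ n : ℕ) : ℝ) * ((4 ^ n : ℕ) : ℝ) := by
  push_cast
  rw [← mul_pow]
  norm_num

/-- The scale is the largest power of 8 below k / 2, so that a block of weight at least 1/2 at time
n + k starts after n. Of its 16^(j+2) pairs of values at most 2·2 produce a hit. The smallest scale
being 64, shorter gaps have no such block; the numerator 256 = 16² of `escapeProb` makes the bound
trivial there. -/
theorem exists_escape {n k : ℕ} (hk : 0 < k) (hM : n + k ≤ M) (v₁ v₂ : ℤ) :
    ∃ i : Fin (M + 1) × Fin (M + 2), n < (i.2.val - 1) * 8 ^ (i.1.val + 2) ∧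
      ∀ ξ : (∀ i, PairLevel (M + 1) M i),
        (#{a : PairLevel (M + 1) M i | walk (fun i' => (update ξ i a i').1) (n + k) = v₁ ∧
          walk (fun i' => (update ξ i a i').2) (n + k) = v₂} : ℝ) ≤
        escapeProb k * Fintype.card (PairLevel (M + 1) M i) := by
  rcases Nat.lt_or_ge (k / 2) 64 with hk2 | hk2
  -- Any coordinate starting after `n` would do here.
  · refine ⟨(0, Fin.last _), ?_, fun ξ => ?_⟩
    · simp only [Fin.val_last, Fin.val_zero]
      norm_num
      omega
    · have hl : Nat.log 8 (k / 2) < 2 := by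
        refine Nat.log_lt_of_lt_pow' (by norm_num) (by simpa using hk2)
      have h1 : (1 : ℝ) ≤ escapeProb k := by
        rw [escapeProb, one_le_div (by positivity)]
        calc (16 : ℝ) ^ Nat.log 8 (k / 2) ≤ 16 ^ 2 := pow_le_pow_right₀ (by norm_num) (by omega)
          _ = 256 := by norm_num
      refine le_trans ?_ (le_mul_of_one_le_left (Nat.cast_nonneg _) h1)
      exact_mod_cast card_le_univ _
  · have hpow : 8 ^ Nat.log 8 (k / 2) ≤ k / 2 := Nat.pow_log_le_self 8 (by omega)
    have hl : 2 ≤ Nat.log 8 (k / 2) := by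
      rw [Nat.le_log_iff_pow_le (by norm_num) (by omega)]
      simpa using hk2
    obtain ⟨j, hj⟩ := Nat.exists_eq_add_of_le' hl
    have hjM : j < M + 1 := by
      have : j + 2 < 8 ^ (j + 2) := Nat.lt_pow_self (by norm_num)
      rw [hj] at hpow
      omega
    rw [hj] at hpow
    obtain ⟨b, hb, hw⟩ := exists_block (M := M) (t := n + k) (n := n) (L := 8 ^ (j + 2))
      (by positivity) hM (by omega)
    refine ⟨(⟨j, hjM⟩, b), hb, fun ξ => ?_⟩
    have hb0 : 0 < b.val - 1 := by
      by_contra h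
      have : b.val - 1 = 0 := by omega
      simp [this] at hb
    have hcard := card_pair_walk_update_eq_le ξ (⟨j, hjM⟩, b) hb0 hw v₁ v₂
    refine (Nat.cast_le.2 hcard).trans ?_
    have hc : (Fintype.card (PairLevel (M + 1) M (⟨j, hjM⟩, b)) : ℝ) = 16 ^ (j + 2) := by
      rw [Fintype.card_prod, Fintype.card_fin, Nat.cast_mul, mul_pow_cast_four]
    rw [hc, escapeProb, hj, div_mul_cancel₀ _ (by positivity)]
    norm_num

/-- For any given pair of sequences, the number of times at which a pair of walks agrees with it
has an exponential moment that is bounded uniformly in the length of the walks. -/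
theorem sum_pow_walk_hits_le (M : ℕ) (v₁ v₂ : ℕ → ℤ) {θ : ℝ} (hθ : 1 ≤ θ)
    (hθD : (θ - 1) * 7680 < 1) :
    ∑ ξ : (∀ i, PairLevel (M + 1) M i), θ ^ #{k ∈ Icc 0 M |
        walk (fun i => (ξ i).1) k = v₁ k ∧ walk (fun i => (ξ i).2) k = v₂ k} ≤
      θ * (1 - (θ - 1) * 7680)⁻¹ * Fintype.card (∀ i, PairLevel (M + 1) M i) := by
  have h := sum_pow_hits_le (A := PairLevel (M + 1) M)
    (fun i => (i.2.val - 1) * 8 ^ (i.1.val + 2))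
    (fun k ξ => walk (fun i => (ξ i).1) k = v₁ k ∧ walk (fun i => (ξ i).2) k = v₂ k)
    escapeProb escapeProb_nonneg M 7680 θ ?_ ?_ (sum_escapeProb_le M) hθ hθD (Nat.zero_le M)
    (fun _ => 1) (fun _ => zero_le_one) (fun _ _ _ _ => rfl)
  · simp only [one_mul, sum_const, card_univ, nsmul_eq_mul, mul_one] at h
    rw [mul_assoc]
    refine le_trans ?_ (mul_le_mul_of_nonneg_left h (zero_le_one.trans hθ))
    rw [Finset.mul_sum]
    -- The extra factor θ pays for time 0, which `sum_pow_hits_le` with `n = 0` does not count.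
    refine sum_le_sum fun ξ _ => ?_
    rw [← pow_succ']
    refine pow_le_pow_right₀ hθ ?_
    rw [show Icc 0 M = insert 0 (Ioc 0 M) by
      ext k
      simp only [mem_Icc, mem_insert, mem_Ioc]
      omega, filter_insert]
    split_ifs
    · exact card_insert_le _ _
    · omega
  · intro n i hi ξ a
    rw [fst_update, snd_update, walk_update_of_lt _ i a.1 hi, walk_update_of_lt _ i a.2 hi]
  · exact fun n k hk hM => exists_escape hk hM _ _

end Walks

/-! ### Directed lattice paths -/

section Paths

open Finset Function

variable {d : ℕ}

/-- The directed path from the origin with the given steps. -/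
def pathPos (dir : ℕ → Fin d) : ℕ → Site d
  | 0 => 0
  | t + 1 => nbr (pathPos dir t) (dir t)

open Classical in
/-- The path stopped on `B`. -/
def stopPos (B : Finset (Site d)) (dir : ℕ → Fin d) : ℕ → Site d
  | 0 => 0
  | t + 1 => if stopPos B dir t ∈ B then stopPos B dir t else nbr (stopPos B dir t) (dir t)

open Classical in
/-- The edge used at time `t` by the path stopped on `B`. -/
def pathEdge (B : Finset (Site d)) (dir : ℕ → Fin d) (t : ℕ) : Option (Site d × Fin d) :=
  if stopPos B dir t ∈ B then none else some (stopPos B dir t, dir t)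

/-- The steps of the path which moves in the directions `i₀` and `i₁` according to the two walks and
in the direction `i₂` otherwise. -/
def pathDir (i₀ i₁ i₂ : Fin d) (w₁ w₂ : ℕ → ℤ) (t : ℕ) : Fin d :=
  if t % 2 = 0 then (if w₁ (t / 2 + 1) = w₁ (t / 2) then i₂ else i₀)
  else (if w₂ (t / 2 + 1) = w₂ (t / 2) then i₂ else i₁)

theorem sum_nbr (x : Site d) (k : Fin d) : ∑ i, nbr x k i = ∑ i, x i + 1 := by
  simp [nbr, sum_add_distrib]

/-- A directed path carries its own clock. Hence two paths can share an edge only at the same time,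
and a path cannot stay in the box beyond time d·n. -/
theorem sum_pathPos (dir : ℕ → Fin d) (t : ℕ) : ∑ i, pathPos dir t i = t := by
  induction t with
  | zero => simp [pathPos]
  | succ t ih => rw [pathPos, sum_nbr, ih]; push_cast; rfl

theorem stopPos_eq_pathPos {B : Finset (Site d)} {dir : ℕ → Fin d} {t : ℕ}
    (h : stopPos B dir t ∉ B) : stopPos B dir t = pathPos dir t := by
  induction t with
  | zero => rfl
  | succ t ih =>
    rw [stopPos] at h ⊢
    split_ifs at h ⊢ with h'
    · exact absurd h' h
    · rw [ih h', pathPos]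

/-- Even steps advance the first walk and odd steps the second, `i₂` being the idle direction; after
2n steps each walk has made n steps. -/
theorem pathPos_pathDir {i₀ i₁ i₂ : Fin d} (h01 : i₀ ≠ i₁) (h02 : i₀ ≠ i₂) (h12 : i₁ ≠ i₂)
    {w₁ w₂ : ℕ → ℤ} (h1 : w₁ 0 = 0) (h2 : w₂ 0 = 0)
    (hs1 : ∀ t, w₁ (t + 1) = w₁ t ∨ w₁ (t + 1) = w₁ t + 1)
    (hs2 : ∀ t, w₂ (t + 1) = w₂ t ∨ w₂ (t + 1) = w₂ t + 1) (n : ℕ) :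
    pathPos (pathDir i₀ i₁ i₂ w₁ w₂) (2 * n) i₀ = w₁ n ∧
      pathPos (pathDir i₀ i₁ i₂ w₁ w₂) (2 * n) i₁ = w₂ n := by
  induction n with
  | zero => simp [pathPos, h1, h2]
  | succ n ih =>
    have e1 : (2 * n + 1) % 2 ≠ 0 := by omega
    have e2 : (2 * n + 1) / 2 = n := by omega
    have e3 : 2 * n % 2 = 0 := by omega
    have e4 : 2 * n / 2 = n := by omega
    have a1 := hs1 n
    have a2 := hs2 n
    rw [show 2 * (n + 1) = 2 * n + 1 + 1 by ring, pathPos, pathPos, pathDir, pathDir, if_neg e1,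
      if_pos e3, e2, e4]
    simp only [nbr, Pi.add_apply, ih.1, ih.2]
    constructor
    · split_ifs <;> simp_all
    · split_ifs <;> simp_all [Ne.symm]

theorem pathEdge_eq_some {B : Finset (Site d)} {dir : ℕ → Fin d} {t : ℕ} {e : Site d × Fin d}
    (h : pathEdge B dir t = some e) : e = (pathPos dir t, dir t) := by
  unfold pathEdge at h
  split_ifs at h with hB
  rw [← stopPos_eq_pathPos hB]
  exact (Option.some.inj h).symm

theorem sum_of_pathEdge_eq_some {B : Finset (Site d)} {dir : ℕ → Fin d} {t : ℕ}
    {e : Site d × Fin d} (h : pathEdge B dir t = some e) : ∑ i, e.1 i = t := by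
  rw [pathEdge_eq_some h, sum_pathPos]

/-- Two paths built from walks share at most two edges for each time at which the walks agree. -/
theorem card_common_edges_le {B : Finset (Site d)} {i₀ i₁ i₂ : Fin d} (h01 : i₀ ≠ i₁)
    (h02 : i₀ ≠ i₂) (h12 : i₁ ≠ i₂) {w₁ w₂ v₁ v₂ : ℕ → ℤ} (hw1 : w₁ 0 = 0) (hw2 : w₂ 0 = 0)
    (hv1 : v₁ 0 = 0) (hv2 : v₂ 0 = 0) (hsw1 : ∀ t, w₁ (t + 1) = w₁ t ∨ w₁ (t + 1) = w₁ t + 1)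
    (hsw2 : ∀ t, w₂ (t + 1) = w₂ t ∨ w₂ (t + 1) = w₂ t + 1)
    (hsv1 : ∀ t, v₁ (t + 1) = v₁ t ∨ v₁ (t + 1) = v₁ t + 1)
    (hsv2 : ∀ t, v₂ (t + 1) = v₂ t ∨ v₂ (t + 1) = v₂ t + 1) (M : ℕ) :
    #{t ∈ range (2 * M) | pathEdge B (pathDir i₀ i₁ i₂ w₁ w₂) t ≠ none ∧
      pathEdge B (pathDir i₀ i₁ i₂ w₁ w₂) t = pathEdge B (pathDir i₀ i₁ i₂ v₁ v₂) t} ≤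
    2 * #{k ∈ Icc 0 M | w₁ k = v₁ k ∧ w₂ k = v₂ k} := by
  -- A common edge at time t forces equal positions at the even one of the times t and t + 1, which
  -- is 2((t + 1) / 2). Only t = 2k − 1 and t = 2k lead to a given k.
  refine card_le_mul_card_image_of_maps_to (f := fun t => (t + 1) / 2) (fun t ht => ?_) 2
    (fun k _ => ?_)
  · simp only [mem_range, mem_filter, mem_Icc] at ht ⊢
    obtain ⟨htM, hne, heq⟩ := ht
    refine ⟨by omega, ?_⟩
    obtain ⟨e, he⟩ := Option.ne_none_iff_exists'.1 hne
    have he' := he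
    rw [heq] at he'
    have h1 := pathEdge_eq_some he
    have h2 := pathEdge_eq_some he'
    rw [h1, Prod.mk.injEq] at h2
    have hpos : pathPos (pathDir i₀ i₁ i₂ w₁ w₂) (2 * ((t + 1) / 2)) =
        pathPos (pathDir i₀ i₁ i₂ v₁ v₂) (2 * ((t + 1) / 2)) := by
      rcases Nat.even_or_odd' t with ⟨n, rfl | rfl⟩
      · rw [show 2 * ((2 * n + 1) / 2) = 2 * n by omega]
        exact h2.1
      · rw [show 2 * ((2 * n + 1 + 1) / 2) = 2 * n + 1 + 1 by omega]
        change nbr (pathPos _ (2 * n + 1)) _ = nbr (pathPos _ (2 * n + 1)) _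
        rw [h2.1, h2.2]
    have hw := pathPos_pathDir h01 h02 h12 hw1 hw2 hsw1 hsw2 ((t + 1) / 2)
    have hv := pathPos_pathDir h01 h02 h12 hv1 hv2 hsv1 hsv2 ((t + 1) / 2)
    rw [hpos] at hw
    exact ⟨hw.1.symm.trans hv.1, hw.2.symm.trans hv.2⟩
  · refine (card_le_card (t := {2 * k - 1, 2 * k}) fun t ht => ?_).trans card_le_two
    have := (mem_filter.1 ht).2
    simp only [mem_insert, mem_singleton]
    omega

theorem nbr_mem_of_notMem_innerBoundary {Λ : Finset (Site d)} {x : Site d} (hx : x ∈ Λ)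
    (hb : x ∉ innerBoundary Λ) (k : Fin d) : nbr x k ∈ Λ ∧ x - Pi.single k 1 ∈ Λ := by
  simp only [innerBoundary, Set.mem_ofPred_eq, not_and, not_exists, not_or, not_not] at hb
  exact hb hx k

theorem stopPos_mem {Λ B : Finset (Site d)} (h0 : (0 : Site d) ∈ Λ)
    (hB : innerBoundary Λ ⊆ (B : Set (Site d))) (dir : ℕ → Fin d) (t : ℕ) :
    stopPos B dir t ∈ Λ := by
  induction t with
  | zero => exact h0
  | succ t ih =>
    rw [stopPos]
    split_ifs with h
    · exact ih
    · exact (nbr_mem_of_notMem_innerBoundary ih (fun hx => h (hB hx)) _).1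

theorem stopPos_mem_of_lt {n : ℕ} {B : Finset (Site d)}
    (hB : innerBoundary (box d n) ⊆ (B : Set (Site d))) (dir : ℕ → Fin d) {t : ℕ}
    (ht : d * n < t) : stopPos B dir t ∈ B := by
  by_contra h
  have h1 := stopPos_mem (by simp [box, Pi.le_def]) hB dir t
  rw [stopPos_eq_pathPos h, box, mem_Icc] at h1
  have h2 := sum_pathPos dir t
  have h3 : ∑ i, pathPos dir t i ≤ ∑ _i : Fin d, (n : ℤ) := sum_le_sum fun i _ => h1.2 i
  rw [h2, sum_const, card_univ, Fintype.card_fin, nsmul_eq_mul] at h3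
  have : t ≤ d * n := by exact_mod_cast h3
  omega

end Paths

/-! ### Concentration of the single-edge law at low temperature -/

section Concentration

open Matrix

variable {m : ℕ} {G : Subgroup (Matrix.unitaryGroup (Fin m) ℂ)}

/-- The matrix of a group element. -/
def toMat (g : G) : Matrix (Fin m) (Fin m) ℂ := ((g : Matrix.unitaryGroup (Fin m) ℂ) : _)

theorem continuous_toMat : Continuous (toMat : G → Matrix (Fin m) (Fin m) ℂ) :=
  continuous_subtype_val.comp continuous_subtype_val

theorem toMat_mul (g h : G) : toMat (g * h) = toMat g * toMat h := rfl

theorem toMat_one : toMat (1 : G) = 1 := rfl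

theorem toMat_inv (g : G) : toMat g⁻¹ = (toMat g)ᴴ := rfl

theorem conjTranspose_toMat_mul (g : G) : (toMat g)ᴴ * toMat g = 1 := by
  rw [← toMat_inv, ← toMat_mul, inv_mul_cancel, toMat_one]

theorem reTr_eq (g : G) : reTr g = (trace (toMat g)).re := rfl

theorem reTr_one : reTr (1 : G) = m := by simp [reTr_eq, toMat_one]

theorem norm_toMat_apply_le (g : G) (i j : Fin m) : ‖toMat g i j‖ ≤ 1 :=
  entry_norm_bound_of_unitary (g : Matrix.unitaryGroup (Fin m) ℂ).2 i j

/-- The square of the Frobenius norm. -/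
def frobSq (X : Matrix (Fin m) (Fin m) ℂ) : ℝ := (trace (Xᴴ * X)).re

theorem frobSq_eq_sum (X : Matrix (Fin m) (Fin m) ℂ) : frobSq X = ∑ j, ∑ i, ‖X i j‖ ^ 2 := by
  simp only [frobSq, trace, diag_apply, mul_apply, conjTranspose_apply, Complex.re_sum]
  refine Finset.sum_congr rfl fun j _ => Finset.sum_congr rfl fun i _ => ?_
  rw [← Complex.normSq_eq_norm_sq, Complex.star_def, mul_comm, Complex.mul_conj]
  simp

theorem frobSq_nonneg (X : Matrix (Fin m) (Fin m) ℂ) : 0 ≤ frobSq X := by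
  rw [frobSq_eq_sum]; positivity

theorem norm_apply_sq_le_frobSq (X : Matrix (Fin m) (Fin m) ℂ) (i j : Fin m) :
    ‖X i j‖ ^ 2 ≤ frobSq X := by
  rw [frobSq_eq_sum]
  calc ‖X i j‖ ^ 2 ≤ ∑ i, ‖X i j‖ ^ 2 :=
        Finset.single_le_sum (f := fun i => ‖X i j‖ ^ 2) (fun _ _ => by positivity)
          (Finset.mem_univ i)
    _ ≤ _ := Finset.single_le_sum (f := fun j => ∑ i, ‖X i j‖ ^ 2) (fun _ _ => by positivity)
          (Finset.mem_univ j)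

theorem re_trace_conjTranspose (X : Matrix (Fin m) (Fin m) ℂ) :
    (trace Xᴴ).re = (trace X).re := by
  rw [trace_conjTranspose]; simp

theorem frobSq_sub (X Y : Matrix (Fin m) (Fin m) ℂ) :
    frobSq (X - Y) = frobSq X - 2 * (trace (Xᴴ * Y)).re + frobSq Y := by
  have h : (trace (Yᴴ * X)).re = (trace (Xᴴ * Y)).re := by
    rw [← re_trace_conjTranspose]; simp
  simp only [frobSq, conjTranspose_sub, sub_mul, mul_sub, trace_sub, Complex.sub_re, h]
  ring

theorem frobSq_toMat (g : G) : frobSq (toMat g) = m := by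
  simp [frobSq, conjTranspose_toMat_mul]

/-- For unitary matrices, Frobenius closeness is the same as a nearly maximal real trace; this is
how the weight controls distances. -/
theorem frobSq_toMat_sub (g h : G) : frobSq (toMat g - toMat h) = 2 * (m - reTr (h⁻¹ * g)) := by
  have : (trace ((toMat g)ᴴ * toMat h)).re = reTr (h⁻¹ * g) := by
    rw [← re_trace_conjTranspose, reTr_eq, toMat_mul, toMat_inv]; simp
  rw [frobSq_sub, frobSq_toMat, frobSq_toMat, this]
  ring

theorem reTr_mul_comm (g h : G) : reTr (g * h) = reTr (h * g) := by
  rw [reTr_eq, reTr_eq, toMat_mul, toMat_mul, trace_mul_comm]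

theorem reTr_le (g : G) : reTr g ≤ m := by
  have := frobSq_toMat_sub g 1
  have h := frobSq_nonneg (toMat g - toMat (1 : G))
  simp only [inv_one, one_mul] at this
  linarith

theorem neg_le_reTr (g : G) : -(m : ℝ) ≤ reTr g := by
  have := frobSq_sub (toMat g) (-1)
  have h := frobSq_nonneg (toMat g - (-1))
  have h1 : frobSq (-1 : Matrix (Fin m) (Fin m) ℂ) = m := by simp [frobSq]
  rw [frobSq_toMat, h1] at this
  simp only [mul_neg, mul_one, trace_neg, Complex.neg_re, re_trace_conjTranspose] at this
  rw [reTr_eq]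
  linarith

/-- The cell of a group element for the grid of mesh `1 / N`. -/
def cell (N : ℕ) (g : G) (p : Fin m × Fin m) : ℤ × ℤ :=
  (⌊N * (toMat g p.1 p.2).re⌋, ⌊N * (toMat g p.1 p.2).im⌋)

theorem sq_sub_le_of_floor_eq {N : ℕ} (hN : 0 < N) {x y : ℝ} (h : ⌊N * x⌋ = ⌊N * y⌋) :
    (x - y) ^ 2 ≤ 1 / N ^ 2 := by
  have hN' : (0 : ℝ) < N := by exact_mod_cast hN
  have h1 := Int.abs_sub_lt_one_of_floor_eq_floor h
  rw [← mul_sub] at h1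
  have h2 : (N * (x - y)) ^ 2 ≤ 1 := by
    rw [← sq_abs]
    nlinarith [abs_nonneg (N * (x - y))]
  rw [le_div_iff₀ (by positivity)]
  nlinarith

theorem le_reTr_of_cell_eq {N : ℕ} (hN : 0 < N) {g h : G} (hc : cell N g = cell N h) :
    m - reTr (h⁻¹ * g) ≤ m ^ 2 / N ^ 2 := by
  have h1 := frobSq_toMat_sub g h
  rw [frobSq_eq_sum] at h1
  have h2 : ∑ j, ∑ i, ‖(toMat g - toMat h) i j‖ ^ 2 ≤
      ∑ _j : Fin m, ∑ _i : Fin m, (2 / N ^ 2 : ℝ) := by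
    refine Finset.sum_le_sum fun j _ => Finset.sum_le_sum fun i _ => ?_
    have hij := congrFun hc (i, j)
    simp only [cell, Prod.mk.injEq] at hij
    have hre := sq_sub_le_of_floor_eq hN hij.1
    have him := sq_sub_le_of_floor_eq hN hij.2
    rw [← Complex.normSq_eq_norm_sq, Complex.normSq_apply]
    simp only [Matrix.sub_apply, Complex.sub_re, Complex.sub_im]
    have : (2 / N ^ 2 : ℝ) = 1 / N ^ 2 + 1 / N ^ 2 := by ring
    rw [this]
    nlinarith
  simp only [Finset.sum_const, Finset.card_univ, Fintype.card_fin, nsmul_eq_mul] at h2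
  have h3 : (m : ℝ) * (m * (2 / N ^ 2)) = 2 * (m ^ 2 / N ^ 2) := by ring
  linarith

theorem cell_mem (N : ℕ) (g : G) : cell N g ∈ Fintype.piFinset fun _ : Fin m × Fin m =>
    Finset.Icc (-N : ℤ) N ×ˢ Finset.Icc (-N : ℤ) N := by
  have key : ∀ x : ℝ, |x| ≤ 1 → ⌊N * x⌋ ∈ Finset.Icc (-N : ℤ) N := by
    intro x hx
    rw [abs_le] at hx
    have hN : (0 : ℝ) ≤ N := Nat.cast_nonneg N
    rw [Finset.mem_Icc, Int.le_floor, ← Int.lt_add_one_iff, Int.floor_lt]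
    push_cast
    constructor <;> nlinarith
  rw [Fintype.mem_piFinset]
  intro p
  have h := norm_toMat_apply_le g p.1 p.2
  exact Finset.mem_product.2 ⟨key _ ((Complex.abs_re_le_norm _).trans h),
    key _ ((Complex.abs_im_le_norm _).trans h)⟩

variable [CompactSpace G]

instance instIsHaarMeasureHaarG : (haarG G).IsHaarMeasure := by unfold haarG; infer_instance

/-- Haar measure of a small ball. -/
theorem one_le_mul_haarG_ball {N : ℕ} (hN : 0 < N) :
    1 ≤ ((2 * N + 1) ^ 2 : ℝ) ^ (m * m) *
      (haarG G).real {g | m - reTr g ≤ (m : ℝ) ^ 2 / N ^ 2} := by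
  set μ := haarG G
  set S : Set G := {g | m - reTr g ≤ (m : ℝ) ^ 2 / N ^ 2} with hS
  set Q := Fintype.piFinset fun _ : Fin m × Fin m =>
    Finset.Icc (-N : ℤ) N ×ˢ Finset.Icc (-N : ℤ) N
  -- Translating a cell by the inverse of one of its elements carries it into the ball `S` without
  -- changing Haar measure.
  have hfib : ∀ q ∈ Q, μ {g : G | cell N g = q} ≤ μ S := by
    intro q _
    rcases Set.eq_empty_or_nonempty {g : G | cell N g = q} with h | ⟨h, hh⟩
    · simp [h]
    · calc μ {g : G | cell N g = q} ≤ μ ((fun g => h⁻¹ * g) ⁻¹' S) := by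
            refine measure_mono fun g hg => ?_
            exact le_reTr_of_cell_eq hN (Eq.trans hg (Eq.symm hh))
        _ = μ S := measure_preimage_mul μ _ S
  have hcover : (Set.univ : Set G) ⊆ ⋃ q ∈ Q, {g : G | cell N g = q} := fun g _ =>
    Set.mem_biUnion (cell_mem N g) rfl
  have h1 : (1 : ENNReal) ≤ Q.card * μ S := by
    calc (1 : ENNReal) = μ Set.univ := measure_univ.symm
      _ ≤ μ (⋃ q ∈ Q, {g : G | cell N g = q}) := measure_mono hcover
      _ ≤ ∑ q ∈ Q, μ {g : G | cell N g = q} := measure_biUnion_finset_le _ _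
      _ ≤ ∑ _q ∈ Q, μ S := Finset.sum_le_sum hfib
      _ = Q.card * μ S := by simp
  have h2 := ENNReal.toReal_mono (by finiteness) h1
  rw [ENNReal.toReal_one, ENNReal.toReal_mul, ENNReal.toReal_natCast] at h2
  have h3 : (Q.card : ℝ) = ((2 * N + 1) ^ 2) ^ (m * m) := by
    have : ((N : ℤ) + 1 + N).toNat = 2 * N + 1 := by omega
    simp [Q, Fintype.card_piFinset, this, sq]
  rwa [h3] at h2

theorem integrable_of_continuous {X E : Type*} [TopologicalSpace X] [CompactSpace X]
    [MeasurableSpace X] [OpensMeasurableSpace X] [NormedAddCommGroup E]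
    [SecondCountableTopologyEither X E] (μ : Measure X) [IsFiniteMeasure μ] {f : X → E}
    (hf : Continuous f) : Integrable f μ :=
  hf.integrable_of_hasCompactSupport (HasCompactSupport.of_compactSpace _)

theorem integral_edgeLaw {E : Type*} [NormedAddCommGroup E] [NormedSpace ℝ E] (β : ℝ) (f : G → E) :
    ∫ g, f g ∂edgeLaw G β =
      (∫ g, Real.exp (β * reTr g) ∂haarG G)⁻¹ • ∫ g, Real.exp (β * reTr g) • f g ∂haarG G := by
  rw [edgeLaw, integral_tilted, ← integral_smul]
  refine integral_congr_ae (ae_of_all _ fun g => ?_)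
  simp only [smul_smul, div_eq_inv_mul]

/-- A Laplace estimate. With N = ⌈β⌉ the ball around 1 has Haar mass at least (6β)^(-K), and on it
the weight is at least exp(βm − m²); so the partition function is exp(βm) up to the power β^(-K).
Beyond the threshold s = (K + 1) log β / β the weight is at most exp(βm) β^(-(K+1)), which beats
that loss by a factor 1/β. -/
theorem exists_integral_sub_reTr_le : ∃ A : ℝ, 0 < A ∧ ∀ β : ℝ, 3 ≤ β →
    ∫ g, (m - reTr g) ∂edgeLaw G β ≤ A * (Real.log β / β) := by
  set K : ℕ := 2 * (m * m) with hK
  refine ⟨(K + 1) + 2 * m * (Real.exp (m ^ 2) * 6 ^ K), by positivity, fun β hβ => ?_⟩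
  have hβ0 : 0 < β := by linarith
  have hlog : 1 ≤ Real.log β := by
    rw [Real.le_log_iff_exp_le hβ0]
    exact (Real.exp_one_lt_d9.le.trans (by norm_num)).trans hβ
  set s : ℝ := (K + 1) * (Real.log β / β) with hs
  have hs0 : 0 ≤ s := by positivity
  set Z := ∫ g : G, Real.exp (β * reTr g) ∂haarG G with hZ
  have hint : Integrable (fun g : G => Real.exp (β * reTr g)) (haarG G) :=
    integrable_exp_of_continuous _ (continuous_const.mul continuous_reTr)
  -- lower bound on the partition function
  have hZlow : Real.exp (β * m) * (Real.exp (-(m ^ 2)) * ((6 * β) ^ K)⁻¹) ≤ Z := by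
    set N := ⌈β⌉₊
    have hNβ : β ≤ N := Nat.le_ceil β
    have hN0 : 0 < N := Nat.ceil_pos.2 hβ0
    have hN2 : (N : ℝ) < β + 1 := Nat.ceil_lt_add_one hβ0.le
    have hball := one_le_mul_haarG_ball (G := G) hN0
    set S : Set G := {g | m - reTr g ≤ (m : ℝ) ^ 2 / N ^ 2} with hS
    have hSm : MeasurableSet S :=
      (isClosed_le (continuous_const.sub continuous_reTr) continuous_const).measurableSet
    have hμ : ((6 * β) ^ K)⁻¹ ≤ (haarG G).real S := by
      rw [inv_le_iff_one_le_mul₀ (by positivity), mul_comm]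
      refine hball.trans (mul_le_mul_of_nonneg_right ?_ measureReal_nonneg)
      rw [← pow_mul]
      exact pow_le_pow_left₀ (by positivity) (by linarith) _
    have h1 : ∀ g ∈ S, Real.exp (β * m - m ^ 2) ≤ Real.exp (β * reTr g) := by
      intro g hg
      rw [Real.exp_le_exp]
      have h2 : (m : ℝ) ^ 2 / N ^ 2 ≤ m ^ 2 / β := by
        gcongr
        nlinarith
      have h3 : β * (m - reTr g) ≤ β * (m ^ 2 / β) :=
        mul_le_mul_of_nonneg_left (le_trans hg h2) hβ0.le
      rw [mul_div_cancel₀ _ hβ0.ne'] at h3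
      linarith
    calc _ = Real.exp (β * m - m ^ 2) * ((6 * β) ^ K)⁻¹ := by
          rw [← mul_assoc, ← Real.exp_add, sub_eq_add_neg]
      _ ≤ Real.exp (β * m - m ^ 2) * (haarG G).real S := by gcongr
      _ = ∫ g in S, Real.exp (β * m - m ^ 2) ∂haarG G := by
          rw [setIntegral_const, smul_eq_mul, mul_comm]
      _ ≤ ∫ g in S, Real.exp (β * reTr g) ∂haarG G :=
          setIntegral_mono_on (integrable_const _).integrableOn hint.integrableOn hSm h1
      _ ≤ Z := setIntegral_le_integral hint (ae_of_all _ fun g => (Real.exp_pos _).le)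
  have hZ0 : 0 < Z := lt_of_lt_of_le (by positivity) hZlow
  -- upper bound on the weighted integral
  have hup : ∫ g : G, Real.exp (β * reTr g) • (m - reTr g) ∂haarG G ≤
      s * Z + 2 * m * Real.exp (β * m - β * s) := by
    have hpt : ∀ g : G, Real.exp (β * reTr g) • (m - reTr g) ≤
        s * Real.exp (β * reTr g) + 2 * m * Real.exp (β * m - β * s) := by
      intro g
      have h1 := reTr_le g
      have h2 := neg_le_reTr g
      rw [smul_eq_mul]
      rcases le_total (m - reTr g) s with h | h
      · have : Real.exp (β * reTr g) * (m - reTr g) ≤ Real.exp (β * reTr g) * s := by gcongr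
        have : 0 ≤ 2 * m * Real.exp (β * m - β * s) := by positivity
        linarith
      · have h3 : Real.exp (β * reTr g) ≤ Real.exp (β * m - β * s) := by
          rw [Real.exp_le_exp]; nlinarith
        have h4 : Real.exp (β * reTr g) * (m - reTr g) ≤
            Real.exp (β * m - β * s) * (2 * m) :=
          mul_le_mul h3 (by linarith) (by linarith) (by positivity)
        have : 0 ≤ s * Real.exp (β * reTr g) := by positivity
        linarith
    calc _ ≤ ∫ g : G, (s * Real.exp (β * reTr g) + 2 * m * Real.exp (β * m - β * s)) ∂haarG G := by
          refine integral_mono ?_ ?_ hpt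
          · exact integrable_of_continuous _ (by
              have := continuous_reTr (G := G)
              fun_prop)
          · exact (hint.const_mul _).add (integrable_const _)
      _ = _ := by
          rw [integral_add (hint.const_mul _) (integrable_const _), integral_const_mul]
          simp [hZ]
  rw [integral_edgeLaw, smul_eq_mul, ← hZ, inv_mul_le_iff₀ hZ0]
  have hβK : Real.exp (-(β * s)) * β ^ K = β⁻¹ := by
    have : β * s = (K + 1 : ℕ) * Real.log β := by
      rw [hs]; push_cast; field_simp
    rw [this, Real.exp_neg, ← Real.log_pow, Real.exp_log (by positivity), pow_succ]
    field_simp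
  have hE : Real.exp (β * m - β * s) ≤ Real.exp (m ^ 2) * 6 ^ K * (Real.log β / β) * Z := by
    have h1 : Real.exp (β * m - β * s) = Real.exp (m ^ 2) * 6 ^ K * β⁻¹ *
        (Real.exp (β * m) * (Real.exp (-(m ^ 2)) * ((6 * β) ^ K)⁻¹)) := by
      rw [sub_eq_add_neg, Real.exp_add, ← hβK, Real.exp_neg ((m : ℝ) ^ 2), mul_pow]
      field_simp
    rw [h1]
    have h2 : β⁻¹ ≤ Real.log β / β := by
      rw [inv_eq_one_div]; gcongr
    gcongr
  calc _ ≤ _ := hup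
    _ ≤ s * Z + 2 * m * (Real.exp (m ^ 2) * 6 ^ K * (Real.log β / β) * Z) := by gcongr
    _ = _ := by rw [hs]; ring

/-- Instead of Cauchy–Schwarz, the inequality x ≤ x²/(2c) + c/2 is integrated with c equal to the
claimed bound. -/
theorem exists_norm_integral_toMat_sub_le : ∃ A : ℝ, 0 < A ∧ ∀ β : ℝ, 3 ≤ β → ∀ i j : Fin m,
    ‖∫ g : G, (toMat g - 1) i j ∂edgeLaw G β‖ ≤ Real.sqrt (A * (Real.log β / β)) := by
  obtain ⟨A, hA, h⟩ := exists_integral_sub_reTr_le (G := G)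
  refine ⟨2 * A, by positivity, fun β hβ i j => ?_⟩
  have hlog : 0 < Real.log β := Real.log_pos (by linarith)
  have hβ0 : 0 < β := by linarith
  set c := Real.sqrt (2 * A * (Real.log β / β)) with hc
  have hc0 : 0 < c := Real.sqrt_pos.2 (by positivity)
  have hcont : Continuous fun g : G => (toMat g - 1) i j :=
    (continuous_toMat.sub continuous_const).matrix_elem i j
  have hcr := continuous_reTr (G := G)
  calc ‖∫ g : G, (toMat g - 1) i j ∂edgeLaw G β‖ ≤ ∫ g : G, ‖(toMat g - 1) i j‖ ∂edgeLaw G β :=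
        norm_integral_le_integral_norm _
    _ ≤ ∫ g : G, ((m - reTr g) / c + c / 2) ∂edgeLaw G β := by
        refine integral_mono (integrable_of_continuous _ hcont.norm)
          (integrable_of_continuous _ (by fun_prop)) fun g => ?_
        have h1 := norm_apply_sq_le_frobSq (toMat g - toMat (1 : G)) i j
        rw [frobSq_toMat_sub, inv_one, one_mul, toMat_one] at h1
        change ‖(toMat g - 1) i j‖ ≤ (m - reTr g) / c + c / 2
        rw [div_add' _ _ _ hc0.ne', le_div_iff₀ hc0]
        nlinarith [sq_nonneg (‖(toMat g - 1) i j‖ - c)]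
    _ = (∫ g : G, (m - reTr g) ∂edgeLaw G β) / c + c / 2 := by
        rw [integral_add (integrable_of_continuous _ (by fun_prop)) (integrable_const _),
          integral_div]
        simp
    _ ≤ (c ^ 2 / 2) / c + c / 2 := by
        have := h β hβ
        rw [hc, Real.sq_sqrt (by positivity)]
        gcongr
        linarith
    _ = c := by field_simp; ring

end Concentration

/-! ### Infinite product measures -/

section InfiniteProduct

open Function ProbabilityTheory

variable {ι : Type*} {X : ι → Type*} [∀ i, MeasurableSpace (X i)] (μ : ∀ i, Measure (X i))
  [∀ i, IsProbabilityMeasure (μ i)]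

theorem measurable_update_prod [DecidableEq ι] (i : ι) :
    Measurable fun p : (∀ i, X i) × X i => update p.1 i p.2 := by
  refine measurable_pi_iff.2 fun j => ?_
  rcases eq_or_ne j i with rfl | h
  · simpa using measurable_snd
  · simp only [update_of_ne h]
    fun_prop

theorem map_update_infinitePi [DecidableEq ι] (i : ι) :
    ((Measure.infinitePi μ).prod (μ i)).map (fun p => update p.1 i p.2) =
      Measure.infinitePi μ := by
  have hmeas := measurable_update_prod (X := X) i
  refine Measure.eq_infinitePi _ fun s t ht => ?_
  rw [Measure.map_apply hmeas (MeasurableSet.pi s.countable_toSet fun i _ => ht i)]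
  have hpre : (fun p : (∀ i, X i) × X i => update p.1 i p.2) ⁻¹' Set.pi s t =
      Set.pi (s.erase i : Finset ι) t ×ˢ (if i ∈ s then t i else Set.univ) := by
    ext ⟨ω, a⟩
    simp only [Set.mem_preimage, Set.mem_pi, Set.mem_prod, Finset.mem_coe, Finset.mem_erase]
    constructor
    · refine fun h => ⟨fun j hj => ?_, ?_⟩
      · simpa [update_of_ne hj.1] using h j hj.2
      · split_ifs with hi
        · simpa using h i hi
        · trivial
    · rintro ⟨h1, h2⟩ j hj
      rcases eq_or_ne j i with rfl | hji
      · simpa [hj] using h2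
      · simpa [update_of_ne hji] using h1 j ⟨hji, hj⟩
  rw [hpre, Measure.prod_prod, Measure.infinitePi_pi μ fun i _ => ht i]
  split_ifs with hi
  · exact Finset.prod_erase_mul s (fun i => μ i (t i)) hi
  · rw [measure_univ, mul_one, Finset.erase_eq_of_notMem hi]

/-- Resampling one coordinate does not change an integral with respect to a product measure. -/
theorem integral_resample [DecidableEq ι] {E : Type*} [NormedAddCommGroup E] [NormedSpace ℝ E]
    (i : ι) {F : (∀ i, X i) → E} (hF : Integrable F (Measure.infinitePi μ)) :
    ∫ ω, F ω ∂Measure.infinitePi μ = ∫ ω, ∫ a, F (update ω i a) ∂μ i ∂Measure.infinitePi μ := by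
  have hmeas := measurable_update_prod (X := X) i
  have hF' := hF
  rw [← map_update_infinitePi μ i] at hF'
  rw [← integral_prod (fun p : (∀ i, X i) × X i => F (update p.1 i p.2))
    (hF'.comp_measurable hmeas)]
  conv_lhs => rw [← map_update_infinitePi μ i]
  exact integral_map hmeas.aemeasurable hF'.aestronglyMeasurable

/-- Both measures agree on cylinders: density times indicator is a product of one-coordinate
functions, integrated by independence. -/
theorem infinitePi_withDensity (ν : ∀ i, Measure (X i)) [∀ i, IsProbabilityMeasure (ν i)]
    (s : Finset ι) (f : ∀ i, X i → ENNReal) (hf : ∀ i, Measurable (f i))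
    (hs : ∀ i ∉ s, f i = fun _ => 1) (hν : ∀ i, ν i = (μ i).withDensity (f i)) :
    (Measure.infinitePi μ).withDensity (fun ω => ∏ i ∈ s, f i (ω i)) = Measure.infinitePi ν := by
  classical
  refine Measure.eq_infinitePi _ fun s' t ht => ?_
  have hmeas : MeasurableSet (Set.pi (s' : Set ι) t) :=
    MeasurableSet.pi s'.countable_toSet fun i _ => ht i
  set h : ∀ i, X i → ENNReal := fun i x => f i x * if i ∈ s' then (t i).indicator 1 x else 1 with hh
  have hhm : ∀ i, Measurable (h i) := fun i => (hf i).mul (by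
    split_ifs
    · exact measurable_one.indicator (ht i)
    · exact measurable_const)
  have key : ∀ ω : ∀ i, X i, (Set.pi (s' : Set ι) t).indicator (fun ω => ∏ i ∈ s, f i (ω i)) ω =
      ∏ i ∈ s ∪ s', h i (ω i) := by
    intro ω
    have h1 : ∏ i ∈ s ∪ s', f i (ω i) = ∏ i ∈ s, f i (ω i) :=
      (Finset.prod_subset Finset.subset_union_left fun i _ hi => by rw [hs i hi]).symm
    have h2 : ∏ i ∈ s ∪ s', (if i ∈ s' then (t i).indicator (1 : X i → ENNReal) (ω i) else 1) =
        ∏ i ∈ s', (t i).indicator (1 : X i → ENNReal) (ω i) := by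
      rw [← Finset.prod_subset (Finset.subset_union_right (s₁ := s) (s₂ := s'))]
      · exact Finset.prod_congr rfl fun i hi => if_pos hi
      · exact fun i _ hi => if_neg hi
    simp only [hh, Finset.prod_mul_distrib, h1, h2]
    by_cases hω : ω ∈ Set.pi (s' : Set ι) t
    · rw [Set.indicator_of_mem hω, Finset.prod_eq_one (s := s'), mul_one]
      exact fun i hi => Set.indicator_of_mem (hω i hi) _
    · rw [Set.indicator_of_notMem hω]
      simp only [Set.mem_pi, not_forall] at hω
      obtain ⟨i, hi, hi'⟩ := hω
      rw [Finset.prod_eq_zero hi (Set.indicator_of_notMem hi' _), mul_zero]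
  rw [withDensity_apply _ hmeas, ← lintegral_indicator hmeas, lintegral_congr key]
  rw [lintegral_prod_eq_prod_lintegral_of_indepFun _ _ (iIndepFun_infinitePi hhm)
    fun i => (hhm i).comp (measurable_pi_apply i)]
  have h3 : ∀ i, ∫⁻ ω, h i (ω i) ∂Measure.infinitePi μ = if i ∈ s' then ν i (t i) else 1 := by
    intro i
    rw [(measurePreserving_eval_infinitePi μ i).lintegral_comp (hhm i)]
    split_ifs with hi
    · rw [hν, withDensity_apply _ (ht i), ← lintegral_indicator (ht i)]
      refine lintegral_congr fun x => ?_
      by_cases hx : x ∈ t i <;> simp [hh, hi, hx]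
    · have : ν i Set.univ = 1 := measure_univ
      rw [hν, withDensity_apply _ .univ, setLIntegral_univ] at this
      simpa [hh, hi] using this
  simp only [h3]
  rw [← Finset.prod_subset (Finset.subset_union_right (s₁ := s) (s₂ := s'))]
  · exact Finset.prod_congr rfl fun i hi => if_pos hi
  · exact fun i _ hi => if_neg hi

end InfiniteProduct

/-! ### Invariance of the Haar measure -/

section Haar

variable {m : ℕ} {G : Subgroup (Matrix.unitaryGroup (Fin m) ℂ)} [CompactSpace G]

theorem eq_haarG (μ : Measure G) [IsProbabilityMeasure μ] [μ.IsMulLeftInvariant] : μ = haarG G := by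
  have h := Measure.isMulInvariant_eq_smul_of_compactSpace μ (haarG G)
  have h1 : μ Set.univ = 1 := measure_univ
  rw [h, Measure.smul_apply, measure_univ] at h1
  rw [h]
  set c := Measure.haarScalarFactor μ (haarG G)
  have : c = 1 := by
    rw [ENNReal.smul_def, smul_eq_mul, mul_one] at h1
    exact_mod_cast h1
  rw [this, one_smul]

instance instIsMulRightInvariantHaarG : (haarG G).IsMulRightInvariant where
  map_mul_right_eq_self g := by
    have : IsProbabilityMeasure (Measure.map (· * g) (haarG G)) :=
      Measure.isProbabilityMeasure_map (measurable_mul_const g).aemeasurable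
    exact eq_haarG _

theorem map_inv_haarG : (haarG G).map (fun g => g⁻¹) = haarG G := by
  have : IsProbabilityMeasure (haarG G).inv :=
    Measure.isProbabilityMeasure_map measurable_inv.aemeasurable
  exact eq_haarG (haarG G).inv

theorem map_mul_mul_haarG (a b : G) : (haarG G).map (fun g => a * g * b) = haarG G := by
  have : (fun g : G => a * g * b) = (fun g => g * b) ∘ fun g => a * g := rfl
  rw [this, ← Measure.map_map (measurable_mul_const b) (measurable_const_mul a),
    map_mul_left_eq_self, map_mul_right_eq_self]

end Haar

/-! ### Gauge transformations -/

section Gauge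

variable {m d : ℕ} {G : Subgroup (Matrix.unitaryGroup (Fin m) ℂ)}

/-- The action of a gauge transformation on the disorder. -/
def gauge (V : Config d G) (ω : Disorder d G) : Disorder d G :=
  fun e => V e.1 * ω e * (V (nbr e.1 e.2))⁻¹

theorem continuous_gauge : Continuous fun p : Disorder d G × Config d G => gauge p.2 p.1 := by
  unfold gauge
  fun_prop

theorem interaction_gauge_mul (Λ : Finset (Site d)) (V U : Config d G) (ω : Disorder d G) :
    interaction Λ (gauge V ω) (V * U) = interaction Λ ω U := by
  refine Finset.sum_congr rfl fun e _ => ?_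
  simp only [gauge, Pi.mul_apply]
  congr 1
  group

theorem continuous_interaction_uncurry (Λ : Finset (Site d)) :
    Continuous fun p : Disorder d G × Config d G => interaction Λ p.1 p.2 := by
  refine continuous_finsetSum _ fun e _ => continuous_reTr.comp ?_
  fun_prop

theorem continuous_weight (β : ℝ) (Λ : Finset (Site d)) :
    Continuous fun p : Disorder d G × Config d G => Real.exp (β * interaction Λ p.1 p.2) :=
  Real.continuous_exp.comp (continuous_const.mul (continuous_interaction_uncurry Λ))

theorem continuous_weight_right (β : ℝ) (Λ : Finset (Site d)) (ω : Disorder d G) :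
    Continuous fun U : Config d G => Real.exp (β * interaction Λ ω U) :=
  Real.continuous_exp.comp (continuous_const.mul (continuous_interaction Λ ω))

theorem continuous_prodMk_config (V : Config d G) :
    Continuous fun ω : Disorder d G => (ω, V) := by fun_prop

theorem continuous_weight_smul_spin (β : ℝ) (Λ : Finset (Site d)) : Continuous fun p : Disorder d G × Config d G =>
    Real.exp (β * interaction Λ p.1 p.2) • toMat (p.2 0) :=
  (continuous_weight β Λ).smul
    (continuous_toMat.comp ((continuous_apply (0 : Site d)).comp continuous_snd))

theorem continuous_weight_smul_spin_right (β : ℝ) (Λ : Finset (Site d)) (ω : Disorder d G) :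
    Continuous fun U : Config d G => Real.exp (β * interaction Λ ω U) • toMat (U 0) :=
  (continuous_weight_right β Λ ω).smul (continuous_toMat.comp (continuous_apply (0 : Site d)))

theorem continuous_weight_left (β : ℝ) {Λ : Finset (Site d)} (V : Config d G) :
    Continuous fun ω : Disorder d G => Real.exp (β * interaction Λ ω V) := by
  have h := (continuous_weight β Λ).comp (continuous_prodMk_config V)
  exact h

variable [CompactSpace G]

/-- The disorder in which the variables in `Λ` have Haar law. -/
def baseLaw (G : Subgroup (Matrix.unitaryGroup (Fin m) ℂ)) [CompactSpace G] (β : ℝ)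
    (Λ : Finset (Site d)) (e : Site d × Fin d) : Measure G :=
  open Classical in if e ∈ edges Λ then haarG G else edgeLaw G β

instance (β : ℝ) (Λ : Finset (Site d)) (e : Site d × Fin d) :
    IsProbabilityMeasure (baseLaw G β Λ e) := by
  unfold baseLaw
  split_ifs <;> infer_instance

/-- Every neighbour of a free site lies in the box. -/
def Enclosed (Λ B : Finset (Site d)) : Prop :=
  ∀ x ∈ Λ \ B, ∀ k, nbr x k ∈ Λ ∧ x - Pi.single k 1 ∈ Λ

theorem enclosed_of_innerBoundary_subset {Λ B : Finset (Site d)}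
    (hB : innerBoundary Λ ⊆ (B : Set (Site d))) : Enclosed Λ B := fun _ hx =>
  nbr_mem_of_notMem_innerBoundary (Finset.mem_sdiff.1 hx).1
    fun h => (Finset.mem_sdiff.1 hx).2 (hB h)

/-- On the edges of `Λ` this is bi-invariance of Haar measure. The other edges touch no free site,
because neighbours of free sites lie in `Λ`, so `V` acts trivially on them. -/
theorem map_gauge_baseLaw (β : ℝ) {Λ B : Finset (Site d)} (h : Enclosed Λ B) {V : Config d G}
    (hV : ∀ x ∉ Λ \ B, V x = 1) :
    (Measure.infinitePi (baseLaw G β Λ)).map (gauge V) = Measure.infinitePi (baseLaw G β Λ) := by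
  have := Measure.infinitePi_map_pi (baseLaw G β Λ)
    (f := fun (e : Site d × Fin d) (g : G) => V e.1 * g * (V (nbr e.1 e.2))⁻¹)
    fun e => by fun_prop
  refine this.trans ?_
  congr 1
  funext e
  unfold baseLaw
  split_ifs with he
  · exact map_mul_mul_haarG _ _
  · have he' : ¬ (e.1 ∈ Λ ∧ nbr e.1 e.2 ∈ Λ) := by simpa [edges] using he
    have h1 : V e.1 = 1 := hV _ fun hx => he' ⟨(Finset.mem_sdiff.1 hx).1, (h _ hx e.2).1⟩
    have h2 : V (nbr e.1 e.2) = 1 := hV _ fun hx => he' ⟨by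
      simpa [nbr] using (h _ hx e.2).2, (Finset.mem_sdiff.1 hx).1⟩
    simp [h1, h2]

/-- The Nishimori condition enters here: with the same `β` for disorder and spins, the density of
the disorder is the Gibbs weight of the configuration `1`. -/
theorem integral_disorderLaw {E : Type*} [NormedAddCommGroup E] [NormedSpace ℝ E] (β : ℝ)
    (Λ : Finset (Site d)) (F : Disorder d G → E) :
    ∫ ω, F ω ∂disorderLaw d G β =
      ((∫ g : G, Real.exp (β * reTr g) ∂haarG G)⁻¹ ^ (edges Λ).card) •
        ∫ ω, Real.exp (β * interaction Λ ω 1) • F ω ∂Measure.infinitePi (baseLaw G β Λ) := by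
  classical
  set z := ∫ g : G, Real.exp (β * reTr g) ∂haarG G with hz
  have hr := continuous_reTr (G := G)
  have hz0 : 0 ≤ z := integral_nonneg fun g => (Real.exp_pos _).le
  set f : G → ENNReal := fun g => ENNReal.ofReal (Real.exp (β * reTr g) / z) with hf
  have hfm : Measurable f := by
    have : Continuous fun g : G => Real.exp (β * reTr g) / z := by fun_prop
    exact (ENNReal.continuous_ofReal.comp this).measurable
  have hdens := infinitePi_withDensity (baseLaw G β Λ) (fun _ => edgeLaw G β) (edges Λ)
    (fun e => if e ∈ edges Λ then f else fun _ => 1)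
    (fun e => by split_ifs; exacts [hfm, measurable_const]) (fun e he => if_neg he) (fun e => by
      unfold baseLaw
      split_ifs
      · rfl
      · exact withDensity_one.symm)
  rw [disorderLaw, ← hdens, integral_withDensity_eq_integral_toReal_smul, ← integral_smul]
  · refine integral_congr_ae (ae_of_all _ fun ω => ?_)
    simp only [smul_smul]
    congr 1
    rw [ENNReal.toReal_prod]
    calc _ = ∏ e ∈ edges Λ, (z⁻¹ * Real.exp (β * reTr (ω e))) := by
          refine Finset.prod_congr rfl fun e he => ?_
          rw [if_pos he, hf, ENNReal.toReal_ofReal (by positivity), div_eq_inv_mul]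
      _ = _ := by
          rw [Finset.prod_mul_distrib, Finset.prod_const, ← Real.exp_sum, ← Finset.mul_sum]
          simp [interaction]
  · refine Finset.measurable_prod _ fun e he => ?_
    rw [if_pos he]
    exact hfm.comp (measurable_pi_apply e)
  · refine ae_of_all _ fun ω => ENNReal.prod_lt_top fun e he => ?_
    rw [if_pos he]
    exact ENNReal.ofReal_lt_top

end Gauge

/-! ### The Nishimori identity -/

section Nishimori

open Matrix

/-- The entrywise norm on matrices, whose topology is by definition the product topology. -/
@[reducible]
def matrixNormedAddCommGroup (m : ℕ) : NormedAddCommGroup (Matrix (Fin m) (Fin m) ℂ) :=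
  { Matrix.normedAddCommGroup with
    toMetricSpace := (Matrix.normedAddCommGroup.toMetricSpace.replaceTopology
      (rfl : (inferInstance : TopologicalSpace (Matrix (Fin m) (Fin m) ℂ)) = _))
    dist_eq := Matrix.normedAddCommGroup.dist_eq }

attribute [local instance] matrixNormedAddCommGroup

@[reducible]
def matrixNormedSpace (m : ℕ) : NormedSpace ℝ (Matrix (Fin m) (Fin m) ℂ) :=
  { norm_smul_le := Matrix.normedSpace.norm_smul_le }

attribute [local instance] matrixNormedSpace

variable {m d : ℕ} {G : Subgroup (Matrix.unitaryGroup (Fin m) ℂ)} [CompactSpace G]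
  (β : ℝ) (Λ B : Finset (Site d))

theorem integral_mul_matrix {X : Type*} [MeasurableSpace X] (μ : Measure X)
    {f : X → Matrix (Fin m) (Fin m) ℂ} (hf : Integrable f μ) (a b : Matrix (Fin m) (Fin m) ℂ) :
    ∫ x, a * f x * b ∂μ = a * (∫ x, f x ∂μ) * b := by
  let L : Matrix (Fin m) (Fin m) ℂ →L[ℝ] Matrix (Fin m) (Fin m) ℂ :=
    LinearMap.toContinuousLinearMap ((LinearMap.mulRight ℝ b).comp (LinearMap.mulLeft ℝ a))
  exact L.integral_comp_comm hf

theorem integral_apply_matrix {X : Type*} [MeasurableSpace X] (μ : Measure X)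
    {f : X → Matrix (Fin m) (Fin m) ℂ} (hf : Integrable f μ) (i j : Fin m) :
    (∫ x, f x ∂μ) i j = ∫ x, f x i j ∂μ := by
  let L : Matrix (Fin m) (Fin m) ℂ →L[ℝ] ℂ :=
    LinearMap.toContinuousLinearMap (Matrix.entryLinearMap ℝ ℂ i j)
  exact (L.integral_comp_comm hf).symm

theorem integral_conjTranspose {X : Type*} [MeasurableSpace X] (μ : Measure X)
    {f : X → Matrix (Fin m) (Fin m) ℂ} (hf : Integrable f μ) :
    ∫ x, (f x)ᴴ ∂μ = (∫ x, f x ∂μ)ᴴ := by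
  let L : Matrix (Fin m) (Fin m) ℂ →L[ℝ] Matrix (Fin m) (Fin m) ℂ :=
    LinearMap.toContinuousLinearMap (Matrix.conjTransposeLinearEquiv (Fin m) (Fin m) ℝ ℂ).toLinearMap
  exact L.integral_comp_comm hf

theorem integral_re_trace {X : Type*} [MeasurableSpace X] (μ : Measure X)
    {f : X → Matrix (Fin m) (Fin m) ℂ} (hf : Integrable f μ) :
    ∫ x, (trace (f x)).re ∂μ = (trace (∫ x, f x ∂μ)).re := by
  let L : Matrix (Fin m) (Fin m) ℂ →L[ℝ] ℝ :=
    LinearMap.toContinuousLinearMap (Complex.reLm.comp (Matrix.traceLinearMap (Fin m) ℝ ℂ))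
  exact L.integral_comp_comm hf

/-- The reference law of the spins. -/
abbrev spinLaw (G : Subgroup (Matrix.unitaryGroup (Fin m) ℂ)) [CompactSpace G]
    (Λ B : Finset (Site d)) : Measure (Config d G) :=
  Measure.infinitePi (siteLaw G Λ B)

theorem ae_spinLaw_eq_one : ∀ᵐ V ∂spinLaw G Λ B, ∀ x ∉ Λ \ B, V x = 1 := by
  rw [ae_all_iff]
  intro x
  by_cases hx : x ∈ Λ \ B
  · exact ae_of_all _ fun _ h => absurd hx h
  · have h := (measurePreserving_eval_infinitePi (siteLaw G Λ B) x).quasiMeasurePreserving.ae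
      (p := fun g => g = 1) (by
        rw [siteLaw, if_neg hx, ae_dirac_eq]
        rfl)
    filter_upwards [h] with V hV _ using hV

theorem map_mul_spinLaw {V : Config d G} (hV : ∀ x ∉ Λ \ B, V x = 1) :
    (spinLaw G Λ B).map (fun U => V * U) = spinLaw G Λ B := by
  refine (Measure.infinitePi_map_pi (siteLaw G Λ B) (f := fun x g => V x * g)
    fun x => measurable_const_mul _).trans ?_
  congr 1
  funext x
  unfold siteLaw
  split_ifs with hx
  · exact map_mul_left_eq_self _ _
  · simp [hV x hx]

theorem map_inv_spinLaw : (spinLaw G Λ B).map (fun U => U⁻¹) = spinLaw G Λ B := by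
  refine (Measure.infinitePi_map_pi (siteLaw G Λ B) (f := fun x g => g⁻¹)
    fun x => measurable_inv).trans ?_
  congr 1
  funext x
  unfold siteLaw
  split_ifs with hx
  · exact map_inv_haarG
  · rw [Measure.map_dirac' measurable_inv, inv_one]

/-- The partition function. -/
def partition (ω : Disorder d G) : ℝ :=
  ∫ U, Real.exp (β * interaction Λ ω U) ∂spinLaw G Λ B

theorem continuous_integral_of_continuous {X Y E : Type*} [TopologicalSpace X]
    [FirstCountableTopology X] [LocallyCompactSpace X] [TopologicalSpace Y] [CompactSpace Y]
    [MeasurableSpace Y] [OpensMeasurableSpace Y] [NormedAddCommGroup E] [NormedSpace ℝ E]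
    [SecondCountableTopologyEither Y E] (μ : Measure Y) [IsFiniteMeasure μ] {f : X × Y → E}
    (hf : Continuous f) : Continuous fun x => ∫ y, f (x, y) ∂μ := by
  have := continuous_parametric_integral_of_continuous (μ := μ) (f := fun x y => f (x, y)) hf
    isCompact_univ
  simpa only [setIntegral_univ] using this

theorem partition_pos (ω : Disorder d G) : 0 < partition β Λ B ω :=
  integral_exp_pos (integrable_exp_of_continuous _
    (continuous_const.mul (continuous_interaction Λ ω)))

theorem continuous_partition : Continuous (partition (G := G) β Λ B) :=
  continuous_integral_of_continuous (spinLaw G Λ B) (continuous_weight β Λ)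

/-- The quenched mean of the spin at the origin. -/
def meanSpin (ω : Disorder d G) : Matrix (Fin m) (Fin m) ℂ :=
  (partition β Λ B ω)⁻¹ •
    ∫ U, Real.exp (β * interaction Λ ω U) • toMat (U 0) ∂spinLaw G Λ B

theorem continuous_meanSpin : Continuous (meanSpin (G := G) β Λ B) :=
  ((continuous_partition β Λ B).inv₀ fun ω => (partition_pos β Λ B ω).ne').smul
    (continuous_integral_of_continuous (spinLaw G Λ B) (continuous_weight_smul_spin β Λ))

theorem integrable_weight_smul_spin (ω : Disorder d G) :
    Integrable (fun U : Config d G => Real.exp (β * interaction Λ ω U) • toMat (U 0))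
      (spinLaw G Λ B) :=
  integrable_of_continuous _ (continuous_weight_smul_spin_right β Λ ω)

theorem integral_reTr_gibbs (ω : Disorder d G) :
    ∫ U, reTr (U 0) ∂(gibbs β Λ B ω : Measure (Config d G)) =
      (trace (meanSpin β Λ B ω)).re := by
  have hint := integrable_weight_smul_spin β Λ B ω
  rw [meanSpin, trace_smul, Complex.smul_re, ← integral_re_trace _ hint]
  change ∫ U, reTr (U 0) ∂(spinLaw G Λ B).tilted _ = _
  rw [integral_tilted, smul_eq_mul, ← integral_const_mul]
  refine integral_congr_ae (ae_of_all _ fun U => ?_)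
  simp only [trace_smul, Complex.smul_re, smul_eq_mul, reTr_eq, partition]
  ring

variable {Λ B}

theorem integral_gauge {E : Type*} [NormedAddCommGroup E] [NormedSpace ℝ E] {V : Config d G}
    (hV : ∀ x ∉ Λ \ B, V x = 1) {f : Config d G → E} (hf : Continuous f)
    [SecondCountableTopologyEither (Config d G) E] :
    ∫ U, f (V * U) ∂spinLaw G Λ B = ∫ U, f U ∂spinLaw G Λ B := by
  have hm : Continuous fun U : Config d G => V * U := continuous_const_mul V
  conv_rhs => rw [← map_mul_spinLaw Λ B hV]
  rw [integral_map hm.measurable.aemeasurable hf.aestronglyMeasurable]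

theorem partition_gauge {V : Config d G} (hV : ∀ x ∉ Λ \ B, V x = 1) (ω : Disorder d G) :
    partition β Λ B (gauge V ω) = partition β Λ B ω := by
  have h := integral_gauge hV (continuous_weight_right β Λ (gauge V ω))
  simp only [interaction_gauge_mul] at h
  exact h.symm

theorem meanSpin_gauge {V : Config d G} (hV : ∀ x ∉ Λ \ B, V x = 1) (ω : Disorder d G) :
    meanSpin β Λ B (gauge V ω) = toMat (V 0) * meanSpin β Λ B ω := by
  have hint := integrable_weight_smul_spin β Λ B ω
  have h := integral_gauge hV (continuous_weight_smul_spin_right β Λ (gauge V ω))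
  simp only [interaction_gauge_mul, Pi.mul_apply, toMat_mul] at h
  rw [meanSpin, partition_gauge β hV, ← h, meanSpin, mul_smul_comm, ← mul_one (toMat (V 0) * _), ← integral_mul_matrix _ hint]
  simp

theorem integral_partition_inv (ω : Disorder d G) :
    ∫ V, Real.exp (β * interaction Λ ω V⁻¹) ∂spinLaw G Λ B = partition β Λ B ω := by
  conv_rhs => rw [partition, ← map_inv_spinLaw Λ B]
  rw [integral_map continuous_inv.measurable.aemeasurable (continuous_weight_right β Λ ω).aestronglyMeasurable]

/-- The integrand of the Nishimori identity. -/
def pairing (Λ B : Finset (Site d)) (T : Disorder d G → Matrix (Fin m) (Fin m) ℂ) (p : Disorder d G × Config d G) :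
    Matrix (Fin m) (Fin m) ℂ :=
  (Real.exp (β * interaction Λ p.1 1) * (partition β Λ B p.1)⁻¹ *
    Real.exp (β * interaction Λ p.1 p.2)) • ((toMat (p.2 0))ᴴ * T p.1)

/-- The integrand of the Nishimori identity after a gauge transformation. -/
def gaugedPairing (Λ B : Finset (Site d)) (T : Disorder d G → Matrix (Fin m) (Fin m) ℂ) (p : Disorder d G × Config d G) :
    Matrix (Fin m) (Fin m) ℂ :=
  (Real.exp (β * interaction Λ p.1 p.2⁻¹) * (partition β Λ B p.1)⁻¹ *
    Real.exp (β * interaction Λ p.1 1)) • T p.1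

theorem continuous_weight_fst : Continuous fun p : Disorder d G × Config d G =>
    Real.exp (β * interaction Λ p.1 1) * (partition β Λ B p.1)⁻¹ := by
  have h1 : Continuous fun ω : Disorder d G =>
      Real.exp (β * interaction Λ ω 1) * (partition β Λ B ω)⁻¹ :=
    (continuous_weight_left β 1).mul
      ((continuous_partition β Λ B).inv₀ fun ω => (partition_pos β Λ B ω).ne')
  exact h1.comp continuous_fst

variable {T : Disorder d G → Matrix (Fin m) (Fin m) ℂ}

theorem continuous_pairing (hT : Continuous T) : Continuous (pairing β Λ B T) := by
  have hU : Continuous fun p : Disorder d G × Config d G => toMat (p.2 0) :=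
    continuous_toMat.comp ((continuous_apply (0 : Site d)).comp continuous_snd)
  have hT' : Continuous fun p : Disorder d G × Config d G => T p.1 := hT.comp continuous_fst
  exact ((continuous_weight_fst β).mul (continuous_weight β Λ)).smul
    (hU.matrix_conjTranspose.mul hT')

theorem continuous_gaugedPairing (hT : Continuous T) : Continuous (gaugedPairing β Λ B T) := by
  have h : Continuous fun p : Disorder d G × Config d G => (p.1, p.2⁻¹) := by fun_prop
  have h1 := (continuous_weight β Λ).comp h
  have h2 : Continuous fun ω : Disorder d G =>
      Real.exp (β * interaction Λ ω 1) := continuous_weight_left β 1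
  have h3 : Continuous fun ω : Disorder d G => (partition β Λ B ω)⁻¹ :=
    (continuous_partition β Λ B).inv₀ fun ω => (partition_pos β Λ B ω).ne'
  exact ((h1.mul (h3.comp continuous_fst)).mul (h2.comp continuous_fst)).smul
    (hT.comp continuous_fst)

theorem integral_pairing (ω : Disorder d G) : ∫ V, pairing β Λ B T (ω, V) ∂spinLaw G Λ B =
    Real.exp (β * interaction Λ ω 1) • ((meanSpin β Λ B ω)ᴴ * T ω) := by
  have hint := integrable_weight_smul_spin β Λ B ω
  have h1 : (meanSpin β Λ B ω)ᴴ = (partition β Λ B ω)⁻¹ •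
      ∫ U, (Real.exp (β * interaction Λ ω U) • toMat (U 0))ᴴ ∂spinLaw G Λ B := by
    rw [meanSpin, conjTranspose_smul, star_trivial, integral_conjTranspose _ hint]
  have hint' : Integrable (fun U : Config d G =>
      (Real.exp (β * interaction Λ ω U) • toMat (U 0))ᴴ) (spinLaw G Λ B) :=
    integrable_of_continuous _ (continuous_weight_smul_spin_right β Λ ω).matrix_conjTranspose
  have h2 := integral_mul_matrix _ hint' 1 (T ω)
  simp only [one_mul] at h2
  rw [h1, smul_mul_assoc, smul_smul, ← h2, ← integral_smul]
  congr 1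
  funext V
  simp only [pairing, conjTranspose_smul, star_trivial, smul_mul_assoc, smul_smul]

theorem integral_gaugedPairing (ω : Disorder d G) :
    ∫ V, gaugedPairing β Λ B T (ω, V) ∂spinLaw G Λ B =
      Real.exp (β * interaction Λ ω 1) • T ω := by
  simp only [gaugedPairing]
  rw [integral_smul_const, integral_mul_const, integral_mul_const, integral_partition_inv,
    mul_inv_cancel₀ (partition_pos β Λ B ω).ne', one_mul]

/-- Gauge invariance of the interaction turns the weight of `V` into that of `1` and the weight of
`1` into that of `V⁻¹`, while covariance of `T` cancels the spin at the origin. Integrating over `V`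
then reproduces the partition function, which cancels its inverse. -/
theorem pairing_gauge {V : Config d G} (hV : ∀ x ∉ Λ \ B, V x = 1)
    (hcov : ∀ ω, T (gauge V ω) = toMat (V 0) * T ω) (ω : Disorder d G) :
    pairing β Λ B T (gauge V ω, V) = gaugedPairing β Λ B T (ω, V) := by
  have e1 : interaction Λ (gauge V ω) V = interaction Λ ω 1 := by
    have := interaction_gauge_mul Λ V 1 ω
    rwa [mul_one] at this
  have e2 : interaction Λ (gauge V ω) 1 = interaction Λ ω V⁻¹ := by
    have := interaction_gauge_mul Λ V V⁻¹ ω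
    rwa [mul_inv_cancel] at this
  simp only [pairing, gaugedPairing]
  rw [e1, e2, partition_gauge β hV, hcov, ← Matrix.mul_assoc, conjTranspose_toMat_mul,
    Matrix.one_mul]

theorem integral_pairing_gauge (hΛ : Enclosed Λ B) (hT : Continuous T) {V : Config d G}
    (hV : ∀ x ∉ Λ \ B, V x = 1) (hcov : ∀ ω, T (gauge V ω) = toMat (V 0) * T ω) :
    ∫ ω, pairing β Λ B T (ω, V) ∂Measure.infinitePi (baseLaw (d := d) G β Λ) =
      ∫ ω, gaugedPairing β Λ B T (ω, V) ∂Measure.infinitePi (baseLaw (d := d) G β Λ) := by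
  have hg := continuous_gauge.comp (continuous_prodMk_config V)
  have hc := (continuous_pairing (Λ := Λ) (B := B) β hT).comp (continuous_prodMk_config V)
  conv_lhs => rw [← map_gauge_baseLaw β hΛ hV]
  refine (integral_map hg.measurable.aemeasurable hc.aestronglyMeasurable).trans ?_
  simp only [Function.comp_apply, pairing_gauge β hV hcov]

/-- **Nishimori identity**: for a gauge covariant observable, pairing with the identity and pairing
with the quenched mean of the spin have the same expectation. -/
theorem nishimori_identity (hΛ : Enclosed Λ B) (hT : Continuous T)
    (hcov : ∀ V : Config d G, (∀ x ∉ Λ \ B, V x = 1) → ∀ ω, T (gauge V ω) = toMat (V 0) * T ω) :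
    ∫ ω, (meanSpin β Λ B ω)ᴴ * T ω ∂disorderLaw d G β = ∫ ω, T ω ∂disorderLaw d G β := by
  rw [integral_disorderLaw β Λ, integral_disorderLaw β Λ]
  congr 1
  simp only [← integral_pairing]
  -- Both sides become double integrals over disorder and spins; exchanging the order allows the
  -- gauge change of the disorder for each fixed `V`.
  rw [integral_congr_ae (ae_of_all _ fun ω =>
      (integral_gaugedPairing (Λ := Λ) (B := B) (T := T) β ω).symm),
    integral_integral_swap (f := fun ω V => pairing β Λ B T (ω, V))
      (integrable_of_continuous _ (continuous_pairing β hT)),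
    integral_integral_swap (f := fun ω V => gaugedPairing β Λ B T (ω, V))
      (integrable_of_continuous _ (continuous_gaugedPairing β hT))]
  refine integral_congr_ae ?_
  filter_upwards [ae_spinLaw_eq_one (G := G) Λ B] with V hV
  exact integral_pairing_gauge β hΛ hT hV (hcov V hV)

/-- Any covariant estimator of the spin at the origin gives a lower bound on the magnetization. -/
theorem le_integral_magnetization (hΛ : Enclosed Λ B) (hT : Continuous T)
    (hcov : ∀ V : Config d G, (∀ x ∉ Λ \ B, V x = 1) → ∀ ω, T (gauge V ω) = toMat (V 0) * T ω) :
    2 * (trace (∫ ω, T ω ∂disorderLaw d G β)).re - ∫ ω, frobSq (T ω) ∂disorderLaw d G β ≤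
      ∫ ω, ∫ U, reTr (U 0) ∂(gibbs β Λ B ω : Measure (Config d G)) ∂disorderLaw d G β := by
  set P := disorderLaw d G β
  set M := meanSpin (G := G) β Λ B
  have hM : Continuous M := continuous_meanSpin β Λ B
  have hfrob : ∀ {X : Disorder d G → Matrix (Fin m) (Fin m) ℂ}, Continuous X →
      Integrable (fun ω => frobSq (X ω)) P := fun hX => integrable_of_continuous _
    (Complex.continuous_re.comp (hX.matrix_conjTranspose.mul hX).matrix_trace)
  have hMT : Integrable (fun ω => (M ω)ᴴ * T ω) P :=
    integrable_of_continuous _ (hM.matrix_conjTranspose.mul hT)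
  have hMM : Integrable (fun ω => (M ω)ᴴ * M ω) P :=
    integrable_of_continuous _ (hM.matrix_conjTranspose.mul hM)
  have h0 : 0 ≤ ∫ ω, frobSq (M ω - T ω) ∂P := integral_nonneg fun ω => frobSq_nonneg _
  have h1 : ∫ ω, frobSq (M ω - T ω) ∂P =
      ∫ ω, frobSq (M ω) ∂P - 2 * ∫ ω, (trace ((M ω)ᴴ * T ω)).re ∂P + ∫ ω, frobSq (T ω) ∂P := by
    have hre : Integrable (fun ω => 2 * (trace ((M ω)ᴴ * T ω)).re) P := integrable_of_continuous _
      (continuous_const.mul (Complex.continuous_re.comp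
        (hM.matrix_conjTranspose.mul hT).matrix_trace))
    simp only [frobSq_sub]
    have e1 := integral_add ((hfrob hM).sub hre) (hfrob hT)
    have e2 := integral_sub (hfrob hM) hre
    rw [integral_const_mul] at e2
    rw [← e2]
    exact e1
  -- The mean spin is itself covariant, so the identity applies to `T = M`.
  have h2 : ∫ ω, frobSq (M ω) ∂P = (trace (∫ ω, M ω ∂P)).re := by
    rw [← nishimori_identity β hΛ hM fun V hV ω => meanSpin_gauge β hV ω, ← integral_re_trace _ hMM]
    rfl
  have h3 : ∫ ω, (trace ((M ω)ᴴ * T ω)).re ∂P = (trace (∫ ω, T ω ∂P)).re := by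
    rw [← nishimori_identity β hΛ hT hcov, ← integral_re_trace _ hMT]
  simp only [integral_reTr_gibbs]
  change _ ≤ ∫ ω, (trace (M ω)).re ∂P
  rw [integral_re_trace _ (integrable_of_continuous _ hM)]
  linarith

end Nishimori

/-! ### Inverses of matrices close to the identity -/

section MatrixBounds

open Matrix
open scoped Matrix.Norms.Operator

variable {m : ℕ}

theorem opNorm_le_of_entry_le {X : Matrix (Fin m) (Fin m) ℂ} {ε : ℝ} (hε : 0 ≤ ε)
    (hX : ∀ i j, ‖X i j‖ ≤ ε) : ‖X‖ ≤ m * ε := by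
  rw [linfty_opNorm_def]
  have : (Finset.univ.sup fun i => ∑ j, ‖X i j‖₊) ≤ (⟨m * ε, by positivity⟩ : NNReal) := by
    refine Finset.sup_le fun i _ => ?_
    refine NNReal.coe_le_coe.1 ?_
    push_cast
    calc ∑ j, ‖X i j‖ ≤ ∑ _j : Fin m, ε := Finset.sum_le_sum fun j _ => hX i j
      _ = m * ε := by simp
  exact_mod_cast this

theorem norm_apply_le_opNorm (X : Matrix (Fin m) (Fin m) ℂ) (i j : Fin m) : ‖X i j‖ ≤ ‖X‖ := by
  rw [linfty_opNorm_def, ← coe_nnnorm, NNReal.coe_le_coe]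
  exact (Finset.single_le_sum (f := fun j => ‖X i j‖₊) (fun _ _ => zero_le)
    (Finset.mem_univ j)).trans (Finset.le_sup (f := fun i => ∑ j, ‖X i j‖₊) (Finset.mem_univ i))

theorem opNorm_one_le : ‖(1 : Matrix (Fin m) (Fin m) ℂ)‖ ≤ 1 := by
  rcases Nat.eq_zero_or_pos m with rfl | h
  · rw [Subsingleton.elim (1 : Matrix (Fin 0) (Fin 0) ℂ) 0]
    simp
  · have : Nonempty (Fin m) := ⟨⟨0, h⟩⟩
    simp

theorem opNorm_pow_le {X : Matrix (Fin m) (Fin m) ℂ} {κ : ℝ} (hX : ‖X‖ ≤ κ) (K : ℕ) :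
    ‖X ^ K‖ ≤ κ ^ K := by
  induction K with
  | zero => simpa using opNorm_one_le
  | succ K ih =>
    rw [pow_succ, pow_succ]
    exact (norm_mul_le _ _).trans
      (mul_le_mul ih hX (norm_nonneg _) (pow_nonneg ((norm_nonneg _).trans hX) _))

theorem re_trace_le (X : Matrix (Fin m) (Fin m) ℂ) : (trace X).re ≤ m * ‖X‖ := by
  refine (Complex.re_le_norm _).trans ((norm_sum_le _ _).trans ?_)
  calc ∑ i, ‖X.diag i‖ ≤ ∑ _i : Fin m, ‖X‖ :=
        Finset.sum_le_sum fun i _ => norm_apply_le_opNorm X i i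
    _ = m * ‖X‖ := by simp

theorem opNorm_le_of_mul_eq_one {D C : Matrix (Fin m) (Fin m) ℂ} {ε : ℝ} (hε : 0 ≤ ε)
    (hεm : m * ε < 1) (hC : ∀ i j, ‖(C - 1) i j‖ ≤ ε) (hDC : D * C = 1) :
    ‖D‖ ≤ (1 - m * ε)⁻¹ := by
  have h1 : D = 1 - D * (C - 1) := by rw [mul_sub, hDC, mul_one]; abel
  have h2 : ‖D‖ ≤ 1 + ‖D‖ * (m * ε) := by
    calc ‖D‖ = ‖1 - D * (C - 1)‖ := congrArg _ h1
      _ ≤ ‖(1 : Matrix (Fin m) (Fin m) ℂ)‖ + ‖D * (C - 1)‖ := norm_sub_le _ _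
      _ ≤ 1 + ‖D‖ * ‖C - 1‖ := add_le_add opNorm_one_le (norm_mul_le _ _)
      _ ≤ 1 + ‖D‖ * (m * ε) := by
        gcongr
        exact opNorm_le_of_entry_le hε hC
  rw [← one_div, le_div_iff₀ (by linarith)]
  linarith

theorem exists_inverse {C : Matrix (Fin m) (Fin m) ℂ} {ε : ℝ} (hε : 0 ≤ ε) (hεm : m * ε < 1)
    (hC : ∀ i j, ‖(C - 1) i j‖ ≤ ε) : ∃ D, D * C = 1 ∧ C * D = 1 ∧
      ∀ K : ℕ, (trace (Dᴴ ^ K * D ^ K)).re ≤ m * ((1 - m * ε)⁻¹ ^ 2) ^ K := by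
  have hdet : IsUnit C := by
    have : CompleteSpace (Matrix (Fin m) (Fin m) ℂ) := FiniteDimensional.complete ℂ _
    have hn : ‖1 - C‖ < 1 := by
      rw [norm_sub_rev]
      exact (opNorm_le_of_entry_le hε hC).trans_lt hεm
    simpa using (Units.oneSub (1 - C) hn).isUnit
  obtain ⟨u, rfl⟩ := hdet
  refine ⟨↑u⁻¹, u.inv_mul, u.mul_inv, fun K => ?_⟩
  set D : Matrix (Fin m) (Fin m) ℂ := ↑u⁻¹
  have h1 : ‖D‖ ≤ (1 - m * ε)⁻¹ := opNorm_le_of_mul_eq_one hε hεm hC u.inv_mul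
  -- The row-sum operator norm is not invariant under conjugate transposition, so `Dᴴ` is bounded as
  -- an inverse of `Cᴴ`, whose entries satisfy the same estimate.
  have h2 : ‖Dᴴ‖ ≤ (1 - m * ε)⁻¹ := by
    refine opNorm_le_of_mul_eq_one (C := (u : Matrix (Fin m) (Fin m) ℂ)ᴴ) hε hεm (fun i j => ?_) ?_
    · have := hC j i
      rw [← conjTranspose_one, ← conjTranspose_sub, conjTranspose_apply, norm_star]
      exact this
    · rw [← conjTranspose_mul, u.mul_inv, conjTranspose_one]
  calc (trace (Dᴴ ^ K * D ^ K)).re ≤ m * ‖Dᴴ ^ K * D ^ K‖ := re_trace_le _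
    _ ≤ m * ((1 - m * ε)⁻¹ ^ K * (1 - m * ε)⁻¹ ^ K) := by
      gcongr
      exact (norm_mul_le _ _).trans (mul_le_mul (opNorm_pow_le h2 K) (opNorm_pow_le h1 K)
        (norm_nonneg _) (pow_nonneg ((norm_nonneg _).trans h2) _))
    _ = _ := by rw [← pow_mul, mul_comm 2 K, pow_mul, sq]

end MatrixBounds

/-! ### Transport along a path -/

section Transport

open Matrix Function

attribute [local instance] matrixNormedAddCommGroup matrixNormedSpace

variable {m d : ℕ} {G : Subgroup (Matrix.unitaryGroup (Fin m) ℂ)}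

/-- The weighted disorder variable on an edge, if there is one. -/
def edgeFactor (D : Matrix (Fin m) (Fin m) ℂ) (o : Option (Site d × Fin d)) (ω : Disorder d G) :
    Matrix (Fin m) (Fin m) ℂ :=
  o.elim 1 fun e => D * toMat (ω e)

/-- The ordered product of the weighted disorder variables along a path. -/
def transport (D : Matrix (Fin m) (Fin m) ℂ) (p : ℕ → Option (Site d × Fin d))
    (ω : Disorder d G) : ℕ → Matrix (Fin m) (Fin m) ℂ
  | 0 => 1
  | t + 1 => transport D p ω t * edgeFactor D (p t) ω

theorem continuous_edgeFactor (D : Matrix (Fin m) (Fin m) ℂ) (o : Option (Site d × Fin d)) :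
    Continuous (edgeFactor (G := G) D o) := by
  cases o with
  | none => exact continuous_const
  | some e => exact continuous_const.mul (continuous_toMat.comp (continuous_apply e))

theorem continuous_transport (D : Matrix (Fin m) (Fin m) ℂ) (p : ℕ → Option (Site d × Fin d))
    (t : ℕ) : Continuous fun ω : Disorder d G => transport D p ω t := by
  induction t with
  | zero => exact continuous_const
  | succ t ih => exact ih.mul (continuous_edgeFactor D (p t))

theorem edgeFactor_update_of_ne (D : Matrix (Fin m) (Fin m) ℂ) {o : Option (Site d × Fin d)}
    {e : Site d × Fin d} (h : o ≠ some e) (ω : Disorder d G) (g : G) :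
    edgeFactor D o (update ω e g) = edgeFactor D o ω := by
  cases o with
  | none => rfl
  | some e' => simp [edgeFactor, update_of_ne (fun h' => h (congrArg some h') : e' ≠ e)]

theorem transport_update_of_ne (D : Matrix (Fin m) (Fin m) ℂ) {p : ℕ → Option (Site d × Fin d)}
    {e : Site d × Fin d} {t : ℕ} (h : ∀ s < t, p s ≠ some e) (ω : Disorder d G) (g : G) :
    transport D p (update ω e g) t = transport D p ω t := by
  induction t with
  | zero => rfl
  | succ t ih =>
    rw [transport, transport, ih fun s hs => h s (hs.trans (Nat.lt_succ_self t)),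
      edgeFactor_update_of_ne D (h t (Nat.lt_succ_self t))]

/-- Gauge factors at intermediate sites cancel because `D` commutes with `G`; only the two endpoints
remain. -/
theorem transport_gauge {D : Matrix (Fin m) (Fin m) ℂ} (hD : ∀ g : G, toMat g * D = D * toMat g)
    (B : Finset (Site d)) (dir : ℕ → Fin d) (V : Config d G) (ω : Disorder d G) (t : ℕ) :
    transport D (pathEdge B dir) (gauge V ω) t * toMat (V (stopPos B dir t)) =
      toMat (V 0) * transport D (pathEdge B dir) ω t := by
  induction t with
  | zero => simp [transport, stopPos]
  | succ t ih =>
    rw [transport, transport, stopPos, pathEdge]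
    split_ifs with h
    · simpa [edgeFactor] using ih
    · have hinv : toMat (V (nbr (stopPos B dir t) (dir t)))⁻¹ *
          toMat (V (nbr (stopPos B dir t) (dir t))) = 1 := by
        rw [← toMat_mul, inv_mul_cancel, toMat_one]
      simp only [edgeFactor, Option.elim_some, gauge, toMat_mul]
      rw [← Matrix.mul_assoc (toMat (V 0)), ← ih]
      simp only [Matrix.mul_assoc, hinv, Matrix.mul_one]
      rw [← Matrix.mul_assoc D, ← hD]
      simp only [Matrix.mul_assoc]

variable [CompactSpace G]

/-- The mean of an edge variable. -/
def meanEdge (G : Subgroup (Matrix.unitaryGroup (Fin m) ℂ)) [CompactSpace G] (β : ℝ) :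
    Matrix (Fin m) (Fin m) ℂ :=
  ∫ g : G, toMat g ∂edgeLaw G β

theorem exists_norm_meanEdge_sub_one_le : ∃ A : ℝ, 0 < A ∧ ∀ β : ℝ, 3 ≤ β → ∀ i j : Fin m,
    ‖(meanEdge G β - 1) i j‖ ≤ Real.sqrt (A * (Real.log β / β)) := by
  obtain ⟨A, hA, h⟩ := exists_norm_integral_toMat_sub_le (G := G)
  refine ⟨A, hA, fun β hβ i j => ?_⟩
  have hint : Integrable (toMat : G → Matrix (Fin m) (Fin m) ℂ) (edgeLaw G β) :=
    integrable_of_continuous _ continuous_toMat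
  have h1 : meanEdge G β - 1 = ∫ g : G, (toMat g - 1) ∂edgeLaw G β := by
    rw [integral_sub hint (integrable_const _)]
    simp [meanEdge]
  have h2 : Integrable (fun g : G => toMat g - 1) (edgeLaw G β) :=
    integrable_of_continuous _ (continuous_toMat.sub continuous_const)
  rw [h1, integral_apply_matrix _ h2]
  exact h β hβ i j

/-- The real trace is a class function and Haar measure is bi-invariant, so the edge law is
invariant under conjugation. -/
theorem toMat_mul_meanEdge (β : ℝ) (h : G) :
    toMat h * meanEdge G β = meanEdge G β * toMat h := by
  have hint : Integrable (toMat : G → Matrix (Fin m) (Fin m) ℂ) (edgeLaw G β) :=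
    integrable_of_continuous _ continuous_toMat
  have hc : Continuous fun g : G => Real.exp (β * reTr g) • toMat g :=
    (Real.continuous_exp.comp (continuous_const.mul continuous_reTr)).smul continuous_toMat
  have key : toMat h * meanEdge G β * toMat h⁻¹ = meanEdge G β := by
    rw [meanEdge, ← integral_mul_matrix _ hint, integral_edgeLaw, integral_edgeLaw]
    congr 1
    conv_rhs => rw [← map_mul_mul_haarG h h⁻¹]
    rw [integral_map (by fun_prop) hc.aestronglyMeasurable]
    congr 1
    funext g
    rw [reTr_mul_comm (h * g), inv_mul_cancel_left, toMat_mul, toMat_mul]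
  calc toMat h * meanEdge G β = toMat h * meanEdge G β * toMat h⁻¹ * toMat h := by
        rw [Matrix.mul_assoc, ← toMat_mul, inv_mul_cancel, toMat_one, Matrix.mul_one]
    _ = _ := by rw [key]

/-- Resampling the edge replaces D Ω by D E[Ω] = 1. -/
theorem integral_mul_edge {β : ℝ} {D : Matrix (Fin m) (Fin m) ℂ} (hD : D * meanEdge G β = 1)
    {X : Disorder d G → Matrix (Fin m) (Fin m) ℂ} (hX : Continuous X) {e : Site d × Fin d}
    (he : ∀ ω g, X (update ω e g) = X ω) :
    ∫ ω, X ω * (D * toMat (ω e)) ∂disorderLaw d G β = ∫ ω, X ω ∂disorderLaw d G β := by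
  have hc : Continuous fun ω : Disorder d G => X ω * (D * toMat (ω e)) :=
    hX.mul (continuous_const.mul (continuous_toMat.comp (continuous_apply e)))
  have hint : Integrable (toMat : G → Matrix (Fin m) (Fin m) ℂ) (edgeLaw G β) :=
    integrable_of_continuous _ continuous_toMat
  refine (integral_resample (fun _ => edgeLaw G β) e (integrable_of_continuous _ hc)).trans ?_
  refine integral_congr_ae (ae_of_all _ fun ω => ?_)
  simp only [he, update_self]
  have := integral_mul_matrix _ hint (X ω * D) 1
  simp only [Matrix.mul_one] at this
  simp only [← Matrix.mul_assoc]
  rw [this, ← meanEdge, Matrix.mul_assoc, hD, Matrix.mul_one]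

theorem integral_edge_mul {β : ℝ} {D : Matrix (Fin m) (Fin m) ℂ} (hD : D * meanEdge G β = 1)
    {X : Disorder d G → Matrix (Fin m) (Fin m) ℂ} (hX : Continuous X) {e : Site d × Fin d}
    (he : ∀ ω g, X (update ω e g) = X ω) :
    ∫ ω, (D * toMat (ω e))ᴴ * X ω ∂disorderLaw d G β = ∫ ω, X ω ∂disorderLaw d G β := by
  have hc : Continuous fun ω : Disorder d G => (X ω)ᴴ * (D * toMat (ω e)) :=
    hX.matrix_conjTranspose.mul
      (continuous_const.mul (continuous_toMat.comp (continuous_apply e)))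
  have h := congrArg conjTranspose (integral_mul_edge hD hX.matrix_conjTranspose
    (e := e) fun ω g => by rw [he])
  rw [← integral_conjTranspose _ (integrable_of_continuous _ hc),
    ← integral_conjTranspose _ (integrable_of_continuous _ hX.matrix_conjTranspose)] at h
  simpa using h

/-- For an edge on both paths, integrating the rest first leaves Dᴴ E[X] D between Ω* and Ω. It
commutes with Ω, which then disappears by unitarity. -/
theorem integral_edge_mul_edge {β : ℝ} {D : Matrix (Fin m) (Fin m) ℂ}
    {X : Disorder d G → Matrix (Fin m) (Fin m) ℂ} (hX : Continuous X) {e : Site d × Fin d}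
    (he : ∀ ω g, X (update ω e g) = X ω)
    (hcomm : ∀ g : G, (Dᴴ * (∫ ω, X ω ∂disorderLaw d G β) * D) * toMat g =
      toMat g * (Dᴴ * (∫ ω, X ω ∂disorderLaw d G β) * D)) :
    ∫ ω, (D * toMat (ω e))ᴴ * X ω * (D * toMat (ω e)) ∂disorderLaw d G β =
      Dᴴ * (∫ ω, X ω ∂disorderLaw d G β) * D := by
  have hXi : Integrable X (disorderLaw d G β) := integrable_of_continuous _ hX
  have hc : Continuous fun ω : Disorder d G => (D * toMat (ω e))ᴴ * X ω * (D * toMat (ω e)) := by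
    have h1 : Continuous fun ω : Disorder d G => D * toMat (ω e) :=
      continuous_const.mul (continuous_toMat.comp (continuous_apply e))
    exact (h1.matrix_conjTranspose.mul hX).mul h1
  have hc2 : Continuous fun q : Disorder d G × G =>
      (D * toMat q.2)ᴴ * X q.1 * (D * toMat q.2) := by
    have h1 : Continuous fun q : Disorder d G × G => D * toMat q.2 :=
      continuous_const.mul (continuous_toMat.comp continuous_snd)
    have h2 : Continuous fun q : Disorder d G × G => X q.1 := hX.comp continuous_fst
    exact (h1.matrix_conjTranspose.mul h2).mul h1
  refine (integral_resample (fun _ => edgeLaw G β) e (integrable_of_continuous _ hc)).trans ?_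
  simp only [he, update_self]
  refine (integral_integral_swap (f := fun ω g => (D * toMat g)ᴴ * X ω * (D * toMat g))
    (integrable_of_continuous _ hc2)).trans ?_
  have h3 : ∀ g : G, ∫ ω, (D * toMat g)ᴴ * X ω * (D * toMat g) ∂disorderLaw d G β =
      Dᴴ * (∫ ω, X ω ∂disorderLaw d G β) * D := by
    intro g
    rw [integral_mul_matrix _ hXi]
    calc _ = (toMat g)ᴴ * ((Dᴴ * (∫ ω, X ω ∂disorderLaw d G β) * D) * toMat g) := by
          rw [conjTranspose_mul]; simp only [Matrix.mul_assoc]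
      _ = _ := by rw [hcomm, ← Matrix.mul_assoc, conjTranspose_toMat_mul, Matrix.one_mul]
  refine (integral_congr_ae (ae_of_all _ h3)).trans ?_
  simp

/-- The mixed second moment of the transports along two directed paths depends only on the number
of common edges. -/
theorem integral_transport_mul_transport {β : ℝ} {D : Matrix (Fin m) (Fin m) ℂ}
    (hD : D * meanEdge G β = 1) (hDG : ∀ g : G, toMat g * D = D * toMat g)
    {p q : ℕ → Option (Site d × Fin d)} (hp : ∀ t e, p t = some e → ∑ i, e.1 i = t)
    (hq : ∀ t e, q t = some e → ∑ i, e.1 i = t) (t : ℕ) :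
    ∫ ω, (transport D p ω t)ᴴ * transport D q ω t ∂disorderLaw d G β =
      Dᴴ ^ ((Finset.range t).filter fun s => p s ≠ none ∧ p s = q s).card *
        D ^ ((Finset.range t).filter fun s => p s ≠ none ∧ p s = q s).card := by
  have hDG' : ∀ g : G, toMat g * Dᴴ = Dᴴ * toMat g := by
    intro g
    have := congrArg conjTranspose (hDG g⁻¹)
    simpa [toMat_inv] using this.symm
  have hcomm : ∀ (K : ℕ) (g : G), (Dᴴ ^ K * D ^ K) * toMat g = toMat g * (Dᴴ ^ K * D ^ K) := by
    intro K g
    have h1 : Commute (toMat g) (Dᴴ ^ K) := Commute.pow_right (hDG' g) K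
    have h2 : Commute (toMat g) (D ^ K) := Commute.pow_right (hDG g) K
    exact (h1.mul_right h2).symm
  have hlt : ∀ {p : ℕ → Option (Site d × Fin d)}, (∀ t e, p t = some e → ∑ i, e.1 i = t) →
      ∀ {t : ℕ} {e : Site d × Fin d}, ∑ i, e.1 i = (t : ℤ) → ∀ s < t, p s ≠ some e := by
    intro p hp t e he s hs h
    have := (hp s e h).symm.trans he
    norm_cast at this
    omega
  induction t with
  | zero => simp [transport]
  | succ t ih =>
    set X : Disorder d G → Matrix (Fin m) (Fin m) ℂ :=
      fun ω => (transport D p ω t)ᴴ * transport D q ω t with hXdef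
    have hX : Continuous X :=
      (continuous_transport D p t).matrix_conjTranspose.mul (continuous_transport D q t)
    -- By the clock of directed paths, an edge used at time `t` does not occur in the earlier
    -- factors. An edge on one path only integrates to 1, and a shared edge contributes one `Dᴴ` and
    -- one `D`.
    have hloc : ∀ e : Site d × Fin d, ∑ i, e.1 i = (t : ℤ) → ∀ ω g, X (update ω e g) = X ω := by
      intro e he ω g
      simp only [hXdef, transport_update_of_ne D (hlt hp he), transport_update_of_ne D (hlt hq he)]
    have hstep : ∀ ω : Disorder d G, (transport D p ω (t + 1))ᴴ * transport D q ω (t + 1) =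
        (edgeFactor D (p t) ω)ᴴ * X ω * edgeFactor D (q t) ω := by
      intro ω
      simp only [transport, conjTranspose_mul, hXdef, Matrix.mul_assoc]
    simp only [hstep]
    rw [Finset.range_add_one, Finset.filter_insert]
    rcases hpt : p t with _ | e <;> rcases hqt : q t with _ | e'
    · simpa [edgeFactor] using ih
    · have := integral_mul_edge hD hX (hloc e' (hq t e' hqt))
      simpa [edgeFactor] using this.trans ih
    · have := integral_edge_mul hD hX (hloc e (hp t e hpt))
      simpa [edgeFactor] using this.trans ih
    · by_cases hee : e = e'
      · subst hee
        rw [if_pos ⟨by simp, rfl⟩, Finset.card_insert_of_notMem (by simp)]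
        set K := ((Finset.range t).filter fun s => p s ≠ none ∧ p s = q s).card
        have hK : Dᴴ * (Dᴴ ^ K * D ^ K) * D = Dᴴ ^ (K + 1) * D ^ (K + 1) := by
          rw [pow_succ', pow_succ]; simp only [Matrix.mul_assoc]
        have := integral_edge_mul_edge (β := β) (D := D) hX (hloc e (hp t e hpt)) (by
          intro g
          rw [ih, hK]
          exact hcomm _ g)
        rw [ih, hK] at this
        exact this
      · rw [if_neg (by simpa using hee)]
        have h1 := integral_edge_mul hD (X := fun ω => X ω * (D * toMat (ω e')))
          (hX.mul (continuous_const.mul (continuous_toMat.comp (continuous_apply e'))))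
          (e := e) fun ω g => by
            rw [hloc e (hp t e hpt), update_of_ne (Ne.symm hee)]
        have h2 := integral_mul_edge hD hX (hloc e' (hq t e' hqt))
        have h3 := h1.trans (h2.trans ih)
        simpa [edgeFactor, Matrix.mul_assoc] using h3

theorem integral_transport {β : ℝ} {D : Matrix (Fin m) (Fin m) ℂ}
    (hD : D * meanEdge G β = 1) (hDG : ∀ g : G, toMat g * D = D * toMat g)
    {p : ℕ → Option (Site d × Fin d)} (hp : ∀ t e, p t = some e → ∑ i, e.1 i = t) (t : ℕ) :
    ∫ ω, transport D p ω t ∂disorderLaw d G β = 1 := by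
  have h0 : ∀ (ω : Disorder d G) (t : ℕ), transport D (fun _ => none) ω t = 1 := by
    intro ω t
    induction t with
    | zero => rfl
    | succ t ih => simp [transport, ih, edgeFactor]
  -- Against the empty path there are no common edges.
  have := integral_transport_mul_transport hD hDG (p := fun _ => none) (q := p)
    (fun _ _ h => by simp at h) hp t
  simpa [h0] using this

end Transport

/-! ### The path estimator -/

section Estimator

open Matrix Function

attribute [local instance] matrixNormedAddCommGroup matrixNormedSpace

variable {m d : ℕ} {G : Subgroup (Matrix.unitaryGroup (Fin m) ℂ)}

/-- The random path with data `ξ`. -/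
def randomPath (B : Finset (Site d)) (i₀ i₁ i₂ : Fin d) {M : ℕ}
    (ξ : ∀ i, PairLevel (M + 1) M i) : ℕ → Option (Site d × Fin d) :=
  pathEdge B (pathDir i₀ i₁ i₂ (walk fun i => (ξ i).1) (walk fun i => (ξ i).2))

/-- The average of the transports along the random paths. -/
def estimator (D : Matrix (Fin m) (Fin m) ℂ) (B : Finset (Site d)) (i₀ i₁ i₂ : Fin d) (M : ℕ)
    (ω : Disorder d G) : Matrix (Fin m) (Fin m) ℂ :=
  (Fintype.card (∀ i, PairLevel (M + 1) M i) : ℝ)⁻¹ •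
    ∑ ξ : (∀ i, PairLevel (M + 1) M i), transport D (randomPath B i₀ i₁ i₂ ξ) ω (2 * M)

theorem continuous_estimator (D : Matrix (Fin m) (Fin m) ℂ) (B : Finset (Site d))
    (i₀ i₁ i₂ : Fin d) (M : ℕ) : Continuous (estimator (G := G) D B i₀ i₁ i₂ M) := by
  have h : Continuous fun ω : Disorder d G => ∑ ξ : (∀ i, PairLevel (M + 1) M i),
      transport D (randomPath B i₀ i₁ i₂ ξ) ω (2 * M) :=
    continuous_finsetSum _ fun ξ _ => continuous_transport D _ _
  exact h.const_smul (Fintype.card (∀ i, PairLevel (M + 1) M i) : ℝ)⁻¹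

theorem estimator_gauge {D : Matrix (Fin m) (Fin m) ℂ} (hD : ∀ g : G, toMat g * D = D * toMat g)
    {n : ℕ} {B : Finset (Site d)} (hB : innerBoundary (box d n) ⊆ (B : Set (Site d)))
    (i₀ i₁ i₂ : Fin d) {M : ℕ} (hM : d * n < 2 * M) {V : Config d G}
    (hV : ∀ x ∉ box d n \ B, V x = 1) (ω : Disorder d G) :
    estimator D B i₀ i₁ i₂ M (gauge V ω) = toMat (V 0) * estimator D B i₀ i₁ i₂ M ω := by
  rw [estimator, estimator, mul_smul_comm, Finset.mul_sum]
  congr 1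
  refine Finset.sum_congr rfl fun ξ _ => ?_
  have h := transport_gauge hD B
    (pathDir i₀ i₁ i₂ (walk fun i => (ξ i).1) (walk fun i => (ξ i).2)) V ω (2 * M)
  have hs := stopPos_mem_of_lt hB
    (pathDir i₀ i₁ i₂ (walk fun i => (ξ i).1) (walk fun i => (ξ i).2)) hM
  rw [hV _ fun hx => (Finset.mem_sdiff.1 hx).2 hs, toMat_one, Matrix.mul_one] at h
  exact h

variable [CompactSpace G]

theorem integral_estimator {β : ℝ} {D : Matrix (Fin m) (Fin m) ℂ} (hD : D * meanEdge G β = 1)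
    (hDG : ∀ g : G, toMat g * D = D * toMat g) (B : Finset (Site d)) (i₀ i₁ i₂ : Fin d) (M : ℕ) :
    ∫ ω, estimator D B i₀ i₁ i₂ M ω ∂disorderLaw d G β = 1 := by
  have hN : (Fintype.card (∀ i, PairLevel (M + 1) M i) : ℝ) ≠ 0 := by
    exact_mod_cast Fintype.card_ne_zero
  have hi : ∀ ξ : (∀ i, PairLevel (M + 1) M i),
      Integrable (fun ω => transport D (randomPath B i₀ i₁ i₂ ξ) ω (2 * M)) (disorderLaw d G β) :=
    fun ξ => integrable_of_continuous _ (continuous_transport D _ _)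
  simp only [estimator]
  rw [integral_smul, integral_finsetSum _ fun ξ _ => hi ξ]
  simp only [randomPath, integral_transport hD hDG fun t e h => sum_of_pathEdge_eq_some h]
  rw [Finset.sum_const, Finset.card_univ, ← Nat.cast_smul_eq_nsmul ℝ, smul_smul,
    inv_mul_cancel₀ hN, one_smul]

/-- Each shared edge costs κ and each meeting of the walks accounts for at most two shared edges, so
θ = κ². One path is frozen as the prescribed pair of sequences while the other is averaged. -/
theorem integral_frobSq_estimator_le {β : ℝ} {D : Matrix (Fin m) (Fin m) ℂ}
    (hD : D * meanEdge G β = 1) (hDG : ∀ g : G, toMat g * D = D * toMat g) {κ : ℝ} (hκ : 1 ≤ κ)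
    (hDκ : ∀ K : ℕ, (trace (Dᴴ ^ K * D ^ K)).re ≤ m * κ ^ K)
    (hκ' : (κ ^ 2 - 1) * 7680 < 1) (B : Finset (Site d)) {i₀ i₁ i₂ : Fin d}
    (h01 : i₀ ≠ i₁) (h02 : i₀ ≠ i₂) (h12 : i₁ ≠ i₂) (M : ℕ) :
    ∫ ω, frobSq (estimator D B i₀ i₁ i₂ M ω) ∂disorderLaw d G β ≤
      m * (κ ^ 2 * (1 - (κ ^ 2 - 1) * 7680)⁻¹) := by
  set N : ℝ := Nat.cast (Fintype.card (∀ i, PairLevel (M + 1) M i)) with hNdef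
  have hN : 0 < N := by
    rw [hNdef]
    exact_mod_cast Fintype.card_pos
  set Y : (∀ i, PairLevel (M + 1) M i) → Disorder d G → Matrix (Fin m) (Fin m) ℂ :=
    fun ξ ω => transport D (randomPath B i₀ i₁ i₂ ξ) ω (2 * M) with hY
  have hYc : ∀ ξ, Continuous (Y ξ) := fun ξ => continuous_transport D _ _
  have hexp : ∀ ω, frobSq (estimator D B i₀ i₁ i₂ M ω) =
      N⁻¹ * (N⁻¹ * ∑ ζ, ∑ ξ, (trace ((Y ξ ω)ᴴ * Y ζ ω)).re) := by
    intro ω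
    simp only [frobSq, estimator, conjTranspose_smul, star_trivial, smul_mul_assoc, mul_smul_comm,
      trace_smul, Complex.smul_re, smul_eq_mul, conjTranspose_sum, Finset.sum_mul, Finset.mul_sum,
      trace_sum, Complex.re_sum]
    rw [Finset.sum_comm]
  have hint : ∀ ξ ζ, Integrable (fun ω => (Y ξ ω)ᴴ * Y ζ ω) (disorderLaw d G β) := fun ξ ζ =>
    integrable_of_continuous _ ((hYc ξ).matrix_conjTranspose.mul (hYc ζ))
  have hint' : ∀ ξ ζ, Integrable (fun ω => (trace ((Y ξ ω)ᴴ * Y ζ ω)).re) (disorderLaw d G β) :=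
    fun ξ ζ => integrable_of_continuous _ (Complex.continuous_re.comp
      ((hYc ξ).matrix_conjTranspose.mul (hYc ζ)).matrix_trace)
  have hpair : ∀ ξ ζ, ∫ ω, (trace ((Y ξ ω)ᴴ * Y ζ ω)).re ∂disorderLaw d G β ≤
      m * (κ ^ 2) ^ (((Finset.Icc 0 M).filter fun k =>
        walk (fun i => (ξ i).1) k = walk (fun i => (ζ i).1) k ∧
          walk (fun i => (ξ i).2) k = walk (fun i => (ζ i).2) k).card) := by
    intro ξ ζ
    rw [integral_re_trace _ (hint ξ ζ)]
    simp only [hY, randomPath]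
    rw [integral_transport_mul_transport hD hDG (fun t e h => sum_of_pathEdge_eq_some h)
      (fun t e h => sum_of_pathEdge_eq_some h)]
    refine (hDκ _).trans (mul_le_mul_of_nonneg_left ?_ (Nat.cast_nonneg m))
    rw [← pow_mul]
    exact pow_le_pow_right₀ hκ (card_common_edges_le h01 h02 h12 (walk_zero _) (walk_zero _)
      (walk_zero _) (walk_zero _) (walk_succ _) (walk_succ _) (walk_succ _) (walk_succ _) M)
  simp only [hexp]
  rw [integral_const_mul, integral_const_mul,
    integral_finsetSum _ fun ζ _ => integrable_finsetSum _ fun ξ _ => hint' ξ ζ]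
  have hsum : ∀ ζ, ∫ ω, ∑ ξ, (trace ((Y ξ ω)ᴴ * Y ζ ω)).re ∂disorderLaw d G β ≤
      m * (κ ^ 2 * (1 - (κ ^ 2 - 1) * 7680)⁻¹ * N) := by
    intro ζ
    rw [integral_finsetSum _ fun ξ _ => hint' ξ ζ]
    refine (Finset.sum_le_sum fun ξ _ => hpair ξ ζ).trans ?_
    rw [← Finset.mul_sum]
    exact mul_le_mul_of_nonneg_left (sum_pow_walk_hits_le M _ _ (one_le_pow₀ hκ) hκ')
      (Nat.cast_nonneg m)
  have htot := Finset.sum_le_sum fun ζ (_ : ζ ∈ Finset.univ) => hsum ζ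
  rw [Finset.sum_const, Finset.card_univ, nsmul_eq_mul, ← hNdef] at htot
  rw [← mul_assoc, ← mul_inv, inv_mul_le_iff₀ (by positivity)]
  calc _ ≤ _ := htot
    _ = _ := by ring

/-- Lower bound on the finite-volume magnetization. -/
theorem le_integral_magnetization_box {β ε : ℝ} (hε : 0 ≤ ε) (hmε : m * ε ≤ 1 / 122880)
    (hC : ∀ i j, ‖(meanEdge G β - 1) i j‖ ≤ ε) (hd : 3 ≤ d) {n : ℕ} {B : Finset (Site d)}
    (hB : innerBoundary (box d n) ⊆ (B : Set (Site d))) :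
    m * (1 - 122896 * (m * ε)) ≤
      ∫ ω, ∫ U, reTr (U 0) ∂(gibbs β (box d n) B ω : Measure (Config d G)) ∂disorderLaw d G β := by
  set δ := m * ε with hδ
  have hδ0 : 0 ≤ δ := by positivity
  obtain ⟨D, hDC, hCD, hDK⟩ := exists_inverse hε (by linarith) hC
  have hDG : ∀ g : G, toMat g * D = D * toMat g := by
    intro g
    calc toMat g * D = D * (meanEdge G β * toMat g) * D := by
          rw [← Matrix.mul_assoc, hDC, Matrix.one_mul]
      _ = D * toMat g := by
          rw [← toMat_mul_meanEdge, Matrix.mul_assoc, Matrix.mul_assoc, hCD, Matrix.mul_one]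
  set κ := (1 - δ)⁻¹ ^ 2 with hκdef
  have hκ : 1 ≤ κ := one_le_pow₀ ((one_le_inv₀ (by linarith)).2 (by linarith))
  -- Here κ² = (1 − δ)^(-4).
  have hθ : κ ^ 2 ≤ 1 + 8 * δ := by
    rw [hκdef, ← pow_mul, inv_pow, inv_le_iff_one_le_mul₀ (by
      have : 0 < 1 - δ := by linarith
      positivity)]
    have h1 : 1 - 2 * δ ≤ (1 - δ) ^ 2 := by nlinarith
    have h2 : 1 - 4 * δ ≤ (1 - δ) ^ (2 * 2) := by
      rw [pow_mul]
      nlinarith [sq_nonneg δ]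
    nlinarith
  set i₀ : Fin d := ⟨0, by omega⟩
  set i₁ : Fin d := ⟨1, by omega⟩
  set i₂ : Fin d := ⟨2, by omega⟩
  have h01 : i₀ ≠ i₁ := by simp [i₀, i₁]
  have h02 : i₀ ≠ i₂ := by simp [i₀, i₂]
  have h12 : i₁ ≠ i₂ := by simp [i₁, i₂]
  -- The path length 2M exceeds d·n, so every path has reached `B`.
  set M := d * n + 1
  have hup := integral_frobSq_estimator_le hDC hDG hκ hDK (by linarith) B h01 h02 h12 M
  have hlow := le_integral_magnetization β (enclosed_of_innerBoundary_subset hB)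
    (continuous_estimator (G := G) D B i₀ i₁ i₂ M)
    fun V hV ω => estimator_gauge hDG hB i₀ i₁ i₂ (by omega) hV ω
  rw [integral_estimator hDC hDG] at hlow
  have htr : (trace (1 : Matrix (Fin m) (Fin m) ℂ)).re = m := by simp
  rw [htr] at hlow
  -- The left side is at most (1 + 8δ) / (1 − 61440 δ) with 61440 = 8·7680. As δ ≤ 1/122880 the
  -- denominator is at least 1/2, whence 122896 = 2 (61440 + 8).
  have hnum : κ ^ 2 * (1 - (κ ^ 2 - 1) * 7680)⁻¹ ≤ 1 + 122896 * δ := by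
    have h1 : 1 - 61440 * δ ≤ 1 - (κ ^ 2 - 1) * 7680 := by linarith
    rw [← div_eq_mul_inv, div_le_iff₀ (by linarith)]
    have h2 : (1 + 122896 * δ) * (1 - 61440 * δ) ≤
        (1 + 122896 * δ) * (1 - (κ ^ 2 - 1) * 7680) :=
      mul_le_mul_of_nonneg_left h1 (by positivity)
    nlinarith
  have := mul_le_mul_of_nonneg_left hnum (Nat.cast_nonneg (α := ℝ) m)
  linarith

end Estimator

/-! ### The infinite-volume limit -/

section Limit

variable {m d : ℕ} {G : Subgroup (Matrix.unitaryGroup (Fin m) ℂ)}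

theorem abs_integral_reTr_le (μ : ProbabilityMeasure (Config d G)) :
    |∫ U, reTr (U 0) ∂(μ : Measure (Config d G))| ≤ m := by
  have h := norm_integral_le_of_norm_le_const (μ := (μ : Measure (Config d G)))
    (f := fun U : Config d G => reTr (U 0)) (C := m)
    (ae_of_all _ fun U => abs_le.2 ⟨neg_le_reTr _, reTr_le _⟩)
  simpa using h

variable [CompactSpace G]

theorem continuous_integral_reTr :
    Continuous fun q : Disorder d G × ProbabilityMeasure (Config d G) =>
      ∫ U, reTr (U 0) ∂(q.2 : Measure (Config d G)) := by
  have hc : Continuous fun U : Config d G => reTr (U 0) :=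
    continuous_reTr.comp (continuous_apply (0 : Site d))
  let f : BoundedContinuousFunction (Config d G) ℝ :=
    BoundedContinuousFunction.mkOfCompact ⟨_, hc⟩
  have h := (ProbabilityMeasure.continuous_integral_boundedContinuousFunction f).comp
    (continuous_snd (X := Disorder d G))
  exact h

/-- The mean of Re Tr U(0) is a bounded, weakly continuous function of the random measure, so its
expectation converges. -/
theorem tendsto_integral_magnetization {β : ℝ} {μ : ℕ → Disorder d G →
      ProbabilityMeasure (Config d G)} {S : Type*} [MeasurableSpace S] {P : Measure S}
    [IsProbabilityMeasure P] {ω : S → Disorder d G} {ν : S → ProbabilityMeasure (Config d G)}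
    (h : TendstoInDistribution (fun k (η : Disorder d G) => (η, μ k η)) atTop
      (fun s => (ω s, ν s)) (fun _ => disorderLaw d G β) P) :
    Tendsto (fun k => ∫ η, ∫ U, reTr (U 0) ∂(μ k η : Measure (Config d G)) ∂disorderLaw d G β)
      atTop (𝓝 (∫ s, ∫ U, reTr (U 0) ∂(ν s : Measure (Config d G)) ∂P)) := by
  let f : BoundedContinuousFunction (Disorder d G × ProbabilityMeasure (Config d G)) ℝ :=
    BoundedContinuousFunction.ofNormedAddCommGroup _ continuous_integral_reTr m
      fun q => abs_integral_reTr_le q.2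
  have ht := ProbabilityMeasure.tendsto_iff_forall_integral_tendsto.1 h.tendsto f
  have h1 : ∀ k, ∫ q, f q ∂((disorderLaw d G β).map fun η => (η, μ k η)) =
      ∫ η, ∫ U, reTr (U 0) ∂(μ k η : Measure (Config d G)) ∂disorderLaw d G β := fun k =>
    integral_map (h.forall_aemeasurable k) f.continuous.aestronglyMeasurable
  have h2 : ∫ q, f q ∂(P.map fun s => (ω s, ν s)) =
      ∫ s, ∫ U, reTr (U 0) ∂(ν s : Measure (Config d G)) ∂P :=
    integral_map h.aemeasurable_limit f.continuous.aestronglyMeasurable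
  rw [← h2]
  simp only [← h1]
  exact ht

end Limit

end NishimoriSpin

end

open NishimoriSpin in
theorem corollary1p11 (d : ℕ) (hd : 3 ≤ d) (m : ℕ)
    (G : Subgroup (Matrix.unitaryGroup (Fin m) ℂ)) [CompactSpace G] :
    ∃ βstar a : ℝ, 0 < βstar ∧ 0 < a ∧ ∀ β : ℝ, βstar ≤ β →
      ∀ B : ℕ → Finset (Site d),
        (∀ n, innerBoundary (box d n) ⊆ (B n : Set (Site d)) ∧ B n ⊆ box d n) →
      ∀ φ : ℕ → ℕ, StrictMono φ →
      ∀ (S : Type*) [MeasurableSpace S] (P : Measure S) [IsProbabilityMeasure P]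
        (ω : S → Disorder d G) (ν : S → ProbabilityMeasure (Config d G)),
        TendstoInDistribution
          (fun (k : ℕ) (η : Disorder d G) => (η, gibbs β (box d (φ k)) (B (φ k)) η)) atTop
          (fun s => (ω s, ν s)) (fun _ => disorderLaw d G β) P →
        (1 - Real.sqrt (a * Real.log β / β)) * reTr (1 : G) ≤
          ∫ s, ∫ U, reTr (U 0) ∂(ν s : Measure (Config d G)) ∂P := by
  obtain ⟨A, hA, hconc⟩ := exists_norm_meanEdge_sub_one_le (G := G)
  have hlim : Tendsto (fun β : ℝ => (m : ℝ) * Real.sqrt (A * (Real.log β / β))) atTop (𝓝 0) := by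
    have h1 : Tendsto (fun β : ℝ => Real.log β / β) atTop (𝓝 0) := by
      simpa using Real.tendsto_pow_log_div_mul_add_atTop 1 0 1 one_ne_zero
    have h2 := (Real.continuous_sqrt.tendsto _).comp (h1.const_mul A)
    simpa using h2.const_mul (m : ℝ)
  obtain ⟨b, hb⟩ := eventually_atTop.1
    (hlim.eventually (ge_mem_nhds (show (0 : ℝ) < 1 / 122880 by norm_num)))
  -- `b` makes m ε ≤ 1/122880 and 3 is required by the concentration bound. The factor 122896 m is
  -- moved under the square root, and the + 1 keeps the constant positive when m = 0.
  refine ⟨max b 3, (122896 * m) ^ 2 * A + 1, by positivity, by positivity,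
    fun β hβ B hB φ _ S _ P _ ω ν hlaw => ?_⟩
  have hβ3 : 3 ≤ β := (le_max_right _ _).trans hβ
  have hlog : 0 ≤ Real.log β / β := div_nonneg (Real.log_nonneg (by linarith)) (by linarith)
  refine ge_of_tendsto' (tendsto_integral_magnetization hlaw) fun k => ?_
  refine le_trans ?_ (le_integral_magnetization_box (Real.sqrt_nonneg (A * (Real.log β / β)))
    (hb β ((le_max_left _ _).trans hβ)) (hconc β hβ3) hd (hB (φ k)).1)
  have hsq : 122896 * (m * Real.sqrt (A * (Real.log β / β))) ≤
      Real.sqrt (((122896 * m) ^ 2 * A + 1) * Real.log β / β) := by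
    rw [← mul_assoc]
    refine Real.le_sqrt_of_sq_le ?_
    rw [mul_pow, Real.sq_sqrt (by positivity), mul_div_assoc]
    nlinarith
  rw [reTr_one, mul_comm]
  exact mul_le_mul_of_nonneg_left (by linarith) (Nat.cast_nonneg m)
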